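/- Let $\Gamma=\mathbb R^3\times\{1,2\}$, with elements $x=(\vec x,\sigma)$ and $\int_\Gamma dx=\sum_{\sigma}\int_{\mathbb R^3}d\vec x$. Let $-\Delta$ be the (self-adjoint) Laplacian on $L^2(\Gamma)$ acting on the space variable, and $\mathfrak S^1$ the trace class operators on $L^2(\Gamma)$. Put $$\mathcal D:=\{\gamma\in\mathfrak S^1 : 0\le\gamma\le 1,\ (-\Delta+1)\gamma\in\mathfrak S^1\},\qquad \mathcal D_{\partial N}:=\{\gamma\in\mathcal D : \operatorname{tr}\gamma=N\}.$$ For $\gamma\in\mathcal D$ let $\gamma(x,y)$ be its integral kernel and $\rho_\gamma(\vec x)=\sum_{\sigma}\sum_n\lambda_n|\xi_n(\vec x,\sigma)|^2$ its density, where $(\xi_n)$ is a complete orthonormal set of eigenvectors of $\gamma$ with eigenvalues $\lambda_n$. For $Z\in\mathbb R$ define the Hartree–Fock functional $\mathcal E^{\mathrm{HF}}_Z:\mathcal D\to\mathbb R$ by $$\mathcal E^{\mathrm{HF}}_Z(\gamma)=\operatorname{tr}\bigl(-\tfrac12\Delta\gamma\bigr)-\int_{\mathbb R^3}\frac{Z\rho_\gamma(\vec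 x)}{|\vec x|}\,d\vec x+\frac12\int_{\mathbb R^3}\!\int_{\mathbb R^3}\frac{\rho_\gamma(\vec x)\rho_\gamma(\vec y)}{|\vec x-\vec y|}\,d\vec x\,d\vec y-\frac12\int_\Gamma\!\int_\Gamma\frac{|\gamma(x,y)|^2}{|\vec x-\vec y|}\,dx\,dy .$$ **Theorem.** Let $N\in\mathbb N$, let $\gamma\in\mathcal D_{\partial N}$, and suppose $\gamma\ne\gamma^2$. Then there exists $\gamma'\in\mathcal D_{\partial N}$ with $\mathcal E^{\mathrm{HF}}_Z(\gamma')<\mathcal E^{\mathrm{HF}}_Z(\gamma)$. In particular, any minimizer of $\mathcal E^{\mathrm{HF}}_Z$ on $\mathcal D_{\partial N}$ is a projection. -/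

import Mathlib

open MeasureTheory
open scoped SchwartzMap Laplacian

noncomputable section

namespace HartreeFock

/-- Position space `ℝ³` with the Euclidean norm. -/
abbrev Space : Type := EuclideanSpace ℝ (Fin 3)

/-- The space-spin set `Γ = ℝ³ × {1, 2}`. -/
abbrev SpinSpace : Type := Space × Fin 2

/-- The measure `dx` on `Γ`: Lebesgue measure in space, summation over the spin. -/
abbrev spinMeasure : Measure SpinSpace := (volume : Measure Space).prod Measure.count

/-- The one-electron Hilbert space `L²(Γ)`. -/
abbrev OneParticle : Type := Lp ℂ 2 spinMeasure

/-! ### Trace class operators -/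

section Trace

variable {H : Type*} [NormedAddCommGroup H] [InnerProductSpace ℂ H] [CompleteSpace H]

/-- `T` is a trace class (equivalently, on a Hilbert space, nuclear) operator: it has an expansion
`T = ∑ n, |uₙ⟩⟨vₙ|` with `∑ n, ‖uₙ‖ ‖vₙ‖ < ∞`. -/
def IsTraceClass (T : H →L[ℂ] H) : Prop :=
  ∃ u v : ℕ → H, Summable (fun n => ‖u n‖ * ‖v n‖) ∧
    ∀ f : H, HasSum (fun n => inner ℂ (v n) f • u n) (T f)

/-- The trace `tr T = ∑ᵢ (eᵢ, T eᵢ)`, computed in some complete orthonormal system `(eᵢ)`.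
For trace class `T` the sum converges absolutely and does not depend on the system. -/
def trace (T : H →L[ℂ] H) : ℂ :=
  ∑' i, inner ℂ ((exists_hilbertBasis ℂ H).choose_spec.choose i)
    (T ((exists_hilbertBasis ℂ H).choose_spec.choose i))

end Trace

/-! ### The Laplacian -/

/-- `u ∈ L²(Γ)` is in the domain of the self-adjoint operator `-Δ` on `L²(Γ)` and `-Δ u = w`:
the identity holds for each spin component in the sense of tempered distributions on `ℝ³`. -/
def HasNegLaplacian (u w : OneParticle) : Prop :=
  ∀ (σ : Fin 2) (φ : 𝓢(Space, ℂ)),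
    ∫ x : Space, w (x, σ) * φ x = -∫ x : Space, u (x, σ) * (Δ φ) x

/-- The bounded operator `S` is the product `-Δ γ`; in particular `γ` maps `L²(Γ)` into the
domain of `-Δ`. -/
def IsNegLaplacianMul (γ S : OneParticle →L[ℂ] OneParticle) : Prop :=
  ∀ f : OneParticle, HasNegLaplacian (γ f) (S f)

open Classical in
/-- The bounded operator `-Δ γ`, if it exists (it is then unique), and `0` otherwise. -/
def negLaplacianMul (γ : OneParticle →L[ℂ] OneParticle) : OneParticle →L[ℂ] OneParticle :=
  if h : ∃ S, IsNegLaplacianMul γ S then h.choose else 0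

/-! ### One-particle density matrices -/

/-- The set `𝒟` of one-particle reduced density matrices of finite kinetic energy: trace class
operators `γ` on `L²(Γ)` with `0 ≤ γ ≤ 1` such that `(-Δ + 1) γ` is trace class. -/
def densityMatrices : Set (OneParticle →L[ℂ] OneParticle) :=
  {γ | IsTraceClass γ ∧ 0 ≤ γ ∧ γ ≤ 1 ∧ ∃ S, IsNegLaplacianMul γ S ∧ IsTraceClass (S + γ)}

/-- The set `𝒟_{∂N}` of those `γ ∈ 𝒟` with `tr γ = N`. -/
def densityMatricesOfTrace (N : ℕ) : Set (OneParticle →L[ℂ] OneParticle) :=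
  {γ | γ ∈ densityMatrices ∧ trace γ = (N : ℂ)}

/-- A complete orthonormal set of eigenvectors of `γ` (natural orbitals) with the corresponding
eigenvalues (occupation numbers). -/
structure NaturalOrbitals (γ : OneParticle →L[ℂ] OneParticle) where
  /-- The index set. -/
  index : Type
  /-- The index set is countable. -/
  countable_index : Countable index
  /-- The complete orthonormal set `(ξₙ)`. -/
  orbital : HilbertBasis index ℂ OneParticle
  /-- The eigenvalues `(λₙ)`. -/
  occupation : index → ℝ
  /-- The eigenvalue equations `γ ξₙ = λₙ ξₙ`. -/
  eigen : ∀ n, γ (orbital n) = (occupation n : ℂ) • orbital n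

open Classical in
/-- The spin-summed one-particle density `ρ_γ(x) = ∑_σ ∑ₙ λₙ |ξₙ(x, σ)|²`, where `(ξₙ)` is a
complete orthonormal set of eigenvectors of `γ` and `(λₙ)` are the corresponding eigenvalues
(`0` if there is no such set). For `γ ∈ 𝒟` such a set exists, and the choice affects `ρ_γ` only on
a null set. -/
def density (γ : OneParticle →L[ℂ] OneParticle) (x : Space) : ℝ :=
  if h : Nonempty (NaturalOrbitals γ) then
    ∑ σ : Fin 2, ∑' n, h.some.occupation n * ‖h.some.orbital n (x, σ)‖ ^ 2
  else 0

/-- The function `K` is a square integrable integral kernel of `γ`. -/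
def IsIntegralKernel (γ : OneParticle →L[ℂ] OneParticle) (K : SpinSpace × SpinSpace → ℂ) : Prop :=
  MemLp K 2 (spinMeasure.prod spinMeasure) ∧
    ∀ f : OneParticle, ∀ᵐ x ∂spinMeasure, γ f x = ∫ y, K (x, y) * f y ∂spinMeasure

open Classical in
/-- The integral kernel `γ(x, y)` (`0` if there is none). For `γ ∈ 𝒟` it exists and is unique up to
null sets. -/
def kernel (γ : OneParticle →L[ℂ] OneParticle) : SpinSpace × SpinSpace → ℂ :=
  if h : ∃ K, IsIntegralKernel γ K then h.choose else 0

/-! ### The Hartree–Fock functional -/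

/-- The kinetic energy `tr(-½ Δ γ)`. -/
def kineticEnergy (γ : OneParticle →L[ℂ] OneParticle) : ℝ :=
  (trace ((1 / 2 : ℂ) • negLaplacianMul γ)).re

/-- The Coulomb energy `D[ρ] = ½ ∫∫ ρ(x) ρ(y) / |x - y| dx dy` of a density on `ℝ³`. -/
def coulombEnergy (ρ : Space → ℝ) : ℝ :=
  1 / 2 * ∫ p : Space × Space, ρ p.1 * ρ p.2 / ‖p.1 - p.2‖

/-- The exchange energy `X[γ] = ½ ∫_Γ ∫_Γ |γ(x, y)|² / |x - y| dx dy`, where `|x - y|` is the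
distance of the space components. -/
def exchangeEnergy (γ : OneParticle →L[ℂ] OneParticle) : ℝ :=
  1 / 2 * ∫ p : SpinSpace × SpinSpace, ‖kernel γ p‖ ^ 2 / ‖p.1.1 - p.2.1‖
    ∂(spinMeasure.prod spinMeasure)

/-- The Hartree–Fock functional of an atom with nuclear charge `Z`. -/
def energy (Z : ℝ) (γ : OneParticle →L[ℂ] OneParticle) : ℝ :=
  kineticEnergy γ - (∫ x : Space, Z * density γ x / ‖x‖) + coulombEnergy (density γ)
    - exchangeEnergy γ

end HartreeFock

end

/-! Since `tr γ` is an integer and the eigenvalues lie in `[0,1]` and tend to zero, `γ` cannot have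
exactly one eigenvalue strictly between `0` and `1`. If it is not a projection there are therefore
two orthonormal eigenvectors `ξᵢ`, `ξⱼ` with fractional occupation. Moving a small amount of
occupation from one to the other, in either direction, `γ ± ε(|ξᵢ⟩⟨ξᵢ| - |ξⱼ⟩⟨ξⱼ|)`, keeps the
eigenvectors, the trace and the bounds `0 ≤ γ ≤ 1`.

Along this line the kinetic and nuclear terms are affine, so the sign of `Z` is irrelevant. Direct
minus exchange energy is quadratic, and by `norm_sq_slater_identity` its second-order density is
`-|ξᵢ(x)ξⱼ(y) - ξⱼ(x)ξᵢ(y)|²/|x-y|`. Its integral is strictly negative, because a Slater determinant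
of two orthonormal orbitals does not vanish. The energy is thus strictly midpoint concave
(`energy_perturb_add_lt`), and one of the two directions lowers it.

The rest of the work shows that the terms are finite and may be computed in any natural orbitals
(`energy_eq`). A function in the domain of `-Δ` on `ℝ³` is bounded by `‖(1-Δ)u‖`, while the Coulomb
singularity is locally square integrable. A truncated Coulomb potential times `γ` is therefore
dominated by `(1-Δ)γ` and has uniformly bounded trace, so the Coulomb potential of the density is
bounded. The exchange integrand is controlled by `|γ(x,y)|² ≤ ρ(x)ρ(y)`, with spin-resolved
densities. -/

noncomputable section

namespace HartreeFock

/-! ### Trace class operators, the trace, and eigenbases of compact operators -/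

section TraceClass

open InnerProductSpace

variable {H : Type*} [NormedAddCommGroup H] [InnerProductSpace ℂ H]

/-- A trace class expansion may be indexed by any countable type. -/
theorem isTraceClass_of_hasSum {ι : Type*} [Countable ι] {T : H →L[ℂ] H}
    (u v : ι → H)
    (hs : Summable fun n => ‖u n‖ * ‖v n‖)
    (h : ∀ f, HasSum (fun n => inner ℂ (v n) f • u n) (T f)) : IsTraceClass T := by
  obtain ⟨e, he⟩ := exists_injective_nat ι
  refine ⟨Function.extend e u 0, Function.extend e v 0, ?_, fun f => ?_⟩
  · have : (fun n => ‖Function.extend e u 0 n‖ * ‖Function.extend e v 0 n‖)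
        = Function.extend e (fun n => ‖u n‖ * ‖v n‖) 0 := by
      ext n
      by_cases hn : ∃ a, e a = n
      · obtain ⟨a, rfl⟩ := hn
        simp [he.extend_apply]
      · simp [Function.extend_apply' _ _ _ hn]
    rw [this]
    exact ((hasSum_extend_zero he).2 hs.hasSum).summable
  · have : (fun n => inner ℂ (Function.extend e v 0 n) f • Function.extend e u 0 n)
        = Function.extend e (fun n => inner ℂ (v n) f • u n) 0 := by
      ext n
      by_cases hn : ∃ a, e a = n
      · obtain ⟨a, rfl⟩ := hn
        simp [he.extend_apply]
      · simp [Function.extend_apply' _ _ _ hn]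
    rw [this]
    exact (hasSum_extend_zero he).2 (h f)

variable {S T : H →L[ℂ] H}

theorem IsTraceClass.add (hS : IsTraceClass S) (hT : IsTraceClass T) : IsTraceClass (S + T) := by
  obtain ⟨u, v, h, h'⟩ := hS
  obtain ⟨a, b, k, k'⟩ := hT
  refine isTraceClass_of_hasSum (Sum.elim u a) (Sum.elim v b) ?_ fun f => ?_
  · exact (HasSum.sum (by simpa [Function.comp_def] using h.hasSum)
      (by simpa [Function.comp_def] using k.hasSum)).summable
  · exact HasSum.sum (by simpa [Function.comp_def] using h' f)
      (by simpa [Function.comp_def] using k' f)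

theorem IsTraceClass.smul (c : ℂ) (hT : IsTraceClass T) : IsTraceClass (c • T) := by
  obtain ⟨u, v, h, h'⟩ := hT
  refine ⟨fun n => c • u n, v, ?_, fun f => ?_⟩
  · simpa [norm_smul, mul_assoc] using h.mul_left ‖c‖
  · simpa [smul_comm c] using (h' f).const_smul c

theorem IsTraceClass.sub (hS : IsTraceClass S) (hT : IsTraceClass T) : IsTraceClass (S - T) := by
  simpa [sub_eq_add_neg] using hS.add (hT.smul (-1))

theorem IsTraceClass.comp_left (B : H →L[ℂ] H) (hT : IsTraceClass T) :
    IsTraceClass (B ∘L T) := by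
  obtain ⟨u, v, h, h'⟩ := hT
  refine ⟨fun n => B (u n), v, ?_, fun f => ?_⟩
  · refine Summable.of_nonneg_of_le (fun _ => by positivity) (fun n => ?_) (h.mul_left ‖B‖)
    rw [← mul_assoc]
    gcongr
    exact B.le_opNorm _
  · simpa using (h' f).mapL B

theorem isTraceClass_rankOne (x y : H) : IsTraceClass (rankOne ℂ x y) :=
  isTraceClass_of_hasSum (ι := Unit) (fun _ => x) (fun _ => y) (Summable.of_finite)
    fun f => by simp [hasSum_unique]

/-- The diagonal sum of a trace class operator in any complete orthonormal system is the sum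
`∑ (vₙ, uₙ)` of any of its expansions. -/
theorem hasSum_inner_of_expansion {u v : ℕ → H} (hs : Summable fun n => ‖u n‖ * ‖v n‖)
    (h : ∀ f, HasSum (fun n => inner ℂ (v n) f • u n) (T f)) {ι : Type*}
    (b : HilbertBasis ι ℂ H) :
    HasSum (fun i => inner ℂ (b i) (T (b i))) (∑' n, inner ℂ (v n) (u n)) := by
  -- Cauchy–Schwarz in `i` followed by Bessel for both vectors makes the double series over `(n, i)`
  -- absolutely convergent.
  have hrow : ∀ n, Summable (fun i => ‖inner ℂ (v n) (b i) * inner ℂ (b i) (u n)‖) ∧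
      ∑' i, ‖inner ℂ (v n) (b i) * inner ℂ (b i) (u n)‖ ≤ ‖u n‖ * ‖v n‖ := by
    intro n
    have hb := fun (s : Finset ι) (x : H) => b.orthonormal.sum_inner_products_le x (s := s)
    have key : ∀ s : Finset ι,
        ∑ i ∈ s, ‖inner ℂ (v n) (b i) * inner ℂ (b i) (u n)‖ ≤ ‖u n‖ * ‖v n‖ := by
      intro s
      refine le_of_sq_le_sq ?_ (by positivity)
      calc (∑ i ∈ s, ‖inner ℂ (v n) (b i) * inner ℂ (b i) (u n)‖) ^ 2
          ≤ (∑ i ∈ s, ‖inner ℂ (b i) (v n)‖ ^ 2) * ∑ i ∈ s, ‖inner ℂ (b i) (u n)‖ ^ 2 := by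
            simp_rw [norm_mul, norm_inner_symm (v n)]
            exact Finset.sum_mul_sq_le_sq_mul_sq _ _ _
        _ ≤ ‖v n‖ ^ 2 * ‖u n‖ ^ 2 := by
            gcongr
            exacts [hb s _, hb s _]
        _ = _ := by ring
    exact ⟨summable_of_sum_le (fun _ => norm_nonneg _) key,
      Real.tsum_le_of_sum_le (fun _ => norm_nonneg _) key⟩
  have hprod : Summable (fun p : ℕ × ι => inner ℂ (v p.1) (b p.2) * inner ℂ (b p.2) (u p.1)) := by
    refine Summable.of_norm ?_
    refine (summable_prod_of_nonneg fun _ => norm_nonneg _).2 ⟨fun n => (hrow n).1, ?_⟩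
    exact Summable.of_nonneg_of_le (fun n => tsum_nonneg fun _ => norm_nonneg _)
      (fun n => (hrow n).2) hs
  -- The double series is summed in both orders: over `i` first it is Parseval for `(vₙ, uₙ)`, over
  -- `n` first it is the expansion of `T (b i)`.
  have h1 := hprod.hasSum.prod_fiberwise fun n => b.hasSum_inner_mul_inner (v n) (u n)
  have h2 : HasSum (fun p : ι × ℕ => inner ℂ (v p.2) (b p.1) * inner ℂ (b p.1) (u p.2)) _ :=
    (Equiv.prodComm ι ℕ).hasSum_iff.2 hprod.hasSum
  have h3 := h2.prod_fiberwise (g := fun i => inner ℂ (b i) (T (b i))) fun i => by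
    simpa [inner_smul_right] using (h (b i)).mapL (innerSL ℂ (b i))
  rwa [← h1.tsum_eq] at h3

/-- The trace is computed by the diagonal sum in any complete orthonormal system. -/
theorem IsTraceClass.hasSum_trace [CompleteSpace H] (hT : IsTraceClass T) {ι : Type*} (b : HilbertBasis ι ℂ H) :
    HasSum (fun i => inner ℂ (b i) (T (b i))) (trace T) := by
  obtain ⟨u, v, hs, h⟩ := hT
  have h1 := hasSum_inner_of_expansion hs h (exists_hilbertBasis ℂ H).choose_spec.choose
  have : trace T = _ := h1.tsum_eq
  rw [this]
  exact hasSum_inner_of_expansion hs h b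

theorem norm_trace_le [CompleteSpace H] {u v : ℕ → H} (hs : Summable fun n => ‖u n‖ * ‖v n‖)
    (h : ∀ f, HasSum (fun n => inner ℂ (v n) f • u n) (T f)) :
    ‖trace T‖ ≤ ∑' n, ‖u n‖ * ‖v n‖ := by
  obtain ⟨w, b, -⟩ := exists_hilbertBasis ℂ H
  rw [((IsTraceClass.hasSum_trace ⟨u, v, hs, h⟩ b).unique (hasSum_inner_of_expansion hs h b))]
  refine tsum_of_norm_bounded hs.hasSum fun n => ?_
  rw [mul_comm]
  exact norm_inner_le_norm _ _

theorem trace_add [CompleteSpace H] (hS : IsTraceClass S) (hT : IsTraceClass T) :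
    trace (S + T) = trace S + trace T := by
  obtain ⟨w, b, -⟩ := exists_hilbertBasis ℂ H
  refine ((hS.add hT).hasSum_trace b).unique ?_
  simpa [inner_add_right] using (hS.hasSum_trace b).add (hT.hasSum_trace b)

theorem trace_smul [CompleteSpace H] (c : ℂ) (hT : IsTraceClass T) : trace (c • T) = c * trace T := by
  obtain ⟨w, b, -⟩ := exists_hilbertBasis ℂ H
  refine ((hT.smul c).hasSum_trace b).unique ?_
  simpa [inner_smul_right] using (hT.hasSum_trace b).mul_left c

theorem trace_sub [CompleteSpace H] (hS : IsTraceClass S) (hT : IsTraceClass T) :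
    trace (S - T) = trace S - trace T := by
  have := trace_add hS (hT.smul (-1))
  rw [trace_smul _ hT] at this
  simpa [sub_eq_add_neg] using this

theorem trace_rankOne [CompleteSpace H] (x y : H) : trace (rankOne ℂ x y) = inner ℂ y x := by
  obtain ⟨w, b, -⟩ := exists_hilbertBasis ℂ H
  refine ((isTraceClass_rankOne x y).hasSum_trace b).unique ?_
  simpa [inner_smul_right] using b.hasSum_inner_mul_inner y x

/-- An operator dominated by `T` factors through `T`. -/
theorem exists_factor_of_norm_le [CompleteSpace H] {B : H →L[ℂ] H} {C : ℝ} (hC : 0 ≤ C)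
    (hB : ∀ f, ‖B f‖ ≤ C * ‖T f‖) :
    ∃ D : H →L[ℂ] H, (∀ f, D (T f) = B f) ∧ ∀ f, ‖D f‖ ≤ C * ‖f‖ := by
  -- The bound makes `T f ↦ B f` well defined and bounded on the range of `T`. It extends by
  -- continuity to the closure `M`, and by zero on the orthogonal complement.
  let M : Submodule ℂ H := T.range.topologicalClosure
  let e : H →ₗ[ℂ] M := (T : H →ₗ[ℂ] H).codRestrict M
    fun x => Submodule.le_topologicalClosure _ ⟨x, rfl⟩
  have hM : IsClosed (M : Set H) := Submodule.isClosed_topologicalClosure _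
  have : CompleteSpace M := hM.completeSpace_coe
  have hd : DenseRange e := by
    intro x
    rw [closure_subtype]
    have : (Subtype.val '' Set.range e : Set H) = T.range := by
      ext y
      simp [e]
    rw [this]
    exact x.2
  have hn : ∀ x, ‖(B : H →ₗ[ℂ] H) x‖ ≤ C * ‖e x‖ := hB
  refine ⟨((B : H →ₗ[ℂ] H).extendOfNorm e) ∘L M.orthogonalProjectionOnto, fun f => ?_, fun f => ?_⟩
  · have h1 : M.orthogonalProjectionOnto (T f) = e f :=
      Submodule.orthogonalProjectionOnto_mem_subspace_eq_self (e f)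
    rw [ContinuousLinearMap.comp_apply, h1]
    exact LinearMap.extendOfNorm_eq hd ⟨C, hn⟩ f
  · refine (LinearMap.norm_extendOfNorm_apply_le hd C hn _).trans ?_
    gcongr
    exact M.norm_orthogonalProjectionOnto_apply_le f

/-- The expansion converges absolutely in operator norm, so `T` is a norm limit of finite rank
operators. -/
theorem IsTraceClass.isCompactOperator [CompleteSpace H] (hT : IsTraceClass T) : IsCompactOperator T := by
  obtain ⟨u, v, hs, h⟩ := hT
  have h1 : Summable fun n => rankOne ℂ (u n) (v n) :=
    Summable.of_norm (by simpa using hs)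
  have h2 : HasSum (fun n => rankOne ℂ (u n) (v n)) T := by
    convert h1.hasSum
    ext f
    exact (h f).unique (by simpa using h1.hasSum.mapL (ContinuousLinearMap.apply ℂ H f))
  refine isCompactOperator_of_tendsto h2 (Filter.Eventually.of_forall fun s => ?_)
  have : ∀ n ∈ s, rankOne ℂ (u n) (v n) ∈ compactOperator (RingHom.id ℂ) H H := fun n _ => by
    change IsCompactOperator (rankOne ℂ (u n) (v n))
    rw [rankOne_def']
    have h1 : IsCompactOperator (innerSL ℂ (v n)) :=
      isCompactOperator_of_locallyCompactSpace_dom _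
    exact h1.clm_comp (ContinuousLinearMap.toSpanSingleton ℂ (u n))
  exact Submodule.sum_mem _ this

/-- Distinct orthonormal vectors are at distance `√2`, so the balls of radius `1/2` around them are
disjoint open sets in a separable space. -/
theorem countable_of_orthonormal [SecondCountableTopology H] {ι : Type*} {b : ι → H}
    (hb : Orthonormal ℂ b) : Countable ι := by
  have hdis : Pairwise (Function.onFun Disjoint fun i => Metric.ball (b i) (1 / 2)) := by
    intro i j hij
    refine Metric.ball_disjoint_ball ?_
    have h2 : ‖b i - b j‖ ^ 2 = 2 := by
      rw [@norm_sub_sq ℂ, hb.2 hij, hb.1, hb.1]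
      norm_num
    rw [dist_eq_norm]
    nlinarith [norm_nonneg (b i - b j)]
  exact Pairwise.countable_of_isOpen_disjoint hdis (fun _ => Metric.isOpen_ball)
    fun i => ⟨b i, Metric.mem_ball_self (by norm_num)⟩

/-- A compact symmetric operator has a complete orthonormal set of eigenvectors. -/
theorem exists_hilbertBasis_eigenvectors {H : Type} [NormedAddCommGroup H] [InnerProductSpace ℂ H]
    [CompleteSpace H] {T : H →L[ℂ] H}
    (hc : IsCompactOperator T) (hs : T.IsSymmetric) :
    ∃ (ι : Type) (b : HilbertBasis ι ℂ H) (μ : ι → ℝ), ∀ i, T (b i) = (μ i : ℂ) • b i := by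
  have hcl : ∀ μ : ℂ, IsClosed (Module.End.eigenspace (T : Module.End ℂ H) μ : Set H) := fun μ => by
    have : (Module.End.eigenspace (T : Module.End ℂ H) μ : Set H) = {x | T x = μ • x} := by
      ext x
      simp
    rw [this]
    exact isClosed_eq T.continuous (continuous_const_smul μ)
  have : ∀ μ : ℂ, CompleteSpace (Module.End.eigenspace (T : Module.End ℂ H) μ) :=
    fun μ => (hcl μ).completeSpace_coe
  choose w c hw using fun μ : ℂ =>
    exists_hilbertBasis ℂ (Module.End.eigenspace (T : Module.End ℂ H) μ)
  have hortho := hs.orthogonalFamily_eigenspaces.orthonormal_sigma_orthonormal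
    fun μ => (c μ).orthonormal
  have hbot : (Submodule.span ℂ (Set.range fun a : Σ μ, w μ =>
      (Module.End.eigenspace (T : Module.End ℂ H) a.1).subtypeₗᵢ (c a.1 a.2)))ᗮ = ⊥ := by
    -- A vector orthogonal to a basis of each eigenspace is orthogonal to every eigenspace, and by
    -- the spectral theorem only `0` is.
    rw [eq_bot_iff, ← ContinuousLinearMap.orthogonalComplement_iSup_eigenspaces_eq_bot hc hs]
    intro x hx
    rw [Submodule.mem_orthogonal'] at hx
    rw [← Submodule.iInf_orthogonal, Submodule.mem_iInf]
    intro μ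
    rw [Submodule.mem_orthogonal']
    intro y hy
    have := (c μ).hasSum_repr ⟨y, hy⟩
    have h2 := (this.mapL (Submodule.subtypeL _)).mapL (innerSL ℂ x)
    refine h2.unique ?_
    convert hasSum_zero with i
    have := hx _ (Submodule.subset_span ⟨⟨μ, i⟩, rfl⟩)
    simp only [Submodule.subtypeL_apply, innerSL_apply_apply, Submodule.coe_smul, inner_smul_right]
    simp only [Submodule.coe_subtypeₗᵢ, Submodule.subtype_apply] at this
    rw [this, mul_zero]
  let b := HilbertBasis.mkOfOrthogonalEqBot hortho hbot
  have hb : ∀ a : Σ μ, w μ, T (b a) = a.1 • b a := fun a => by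
    simp only [b, HilbertBasis.coe_mkOfOrthogonalEqBot]
    exact Module.End.mem_eigenspace_iff.1 (c a.1 a.2).2
  refine ⟨Σ μ, w μ, b, fun a => a.1.re, fun a => ?_⟩
  have hconj := hs.conj_eigenvalue_eq_self (μ := a.1)
    (Module.End.hasEigenvalue_of_hasEigenvector
      ⟨Module.End.mem_eigenspace_iff.2 (hb a), b.orthonormal.ne_zero a⟩)
  rw [hb a, Complex.conj_eq_iff_re.1 hconj]

end TraceClass

/-! ### Integration over the two spin components -/

section Spin

theorem measurableEmbedding_spin (σ : Fin 2) :
    MeasurableEmbedding (fun x : Space => ((x, σ) : SpinSpace)) :=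
  MeasurableEmbedding.prodMk_right MeasurableEmbedding.id σ

theorem spinMeasure_eq_sum :
    spinMeasure = ∑ σ : Fin 2, (volume : Measure Space).map (fun x => ((x, σ) : SpinSpace)) := by
  have h : (Measure.count : Measure (Fin 2)) = Measure.dirac 0 + Measure.dirac 1 := by
    rw [Measure.count, Measure.sum_fintype, Fin.sum_univ_two]
  rw [spinMeasure, h, Measure.prod_add, Measure.prod_dirac, Measure.prod_dirac, Fin.sum_univ_two]

theorem ae_spin_iff {p : SpinSpace → Prop} :
    (∀ᵐ x ∂spinMeasure, p x) ↔ ∀ σ : Fin 2, ∀ᵐ x : Space, p (x, σ) := by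
  rw [spinMeasure_eq_sum, Fin.sum_univ_two, ae_add_measure_iff, Fin.forall_fin_two,
    (measurableEmbedding_spin 0).ae_map_iff, (measurableEmbedding_spin 1).ae_map_iff]

theorem integrable_spin_iff {E : Type*} [NormedAddCommGroup E] {f : SpinSpace → E} :
    Integrable f spinMeasure ↔ ∀ σ : Fin 2, Integrable fun x : Space => f (x, σ) := by
  rw [spinMeasure_eq_sum, Fin.sum_univ_two, integrable_add_measure, Fin.forall_fin_two,
    (measurableEmbedding_spin 0).integrable_map_iff, (measurableEmbedding_spin 1).integrable_map_iff]
  rfl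

theorem integral_spin {E : Type*} [NormedAddCommGroup E] [NormedSpace ℝ E] {f : SpinSpace → E}
    (hf : Integrable f spinMeasure) :
    ∫ x, f x ∂spinMeasure = ∑ σ : Fin 2, ∫ x : Space, f (x, σ) := by
  have h := hf
  rw [spinMeasure_eq_sum, Fin.sum_univ_two, integrable_add_measure] at h
  rw [spinMeasure_eq_sum, Fin.sum_univ_two, Fin.sum_univ_two, integral_add_measure h.1 h.2,
    (measurableEmbedding_spin 0).integral_map, (measurableEmbedding_spin 1).integral_map]

theorem integrable_norm_sq (f : OneParticle) : Integrable (fun x => ‖f x‖ ^ 2) spinMeasure :=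
  (memLp_two_iff_integrable_sq_norm (Lp.aestronglyMeasurable f)).1 (Lp.memLp f)

theorem memLp_slice (f : OneParticle) (σ : Fin 2) : MemLp (fun x : Space => f (x, σ)) 2 := by
  refine (memLp_two_iff_integrable_sq_norm ?_).2 ?_
  · exact ((Lp.stronglyMeasurable f).comp_measurable
      (measurableEmbedding_spin σ).measurable).aestronglyMeasurable
  · exact integrable_spin_iff.1 (integrable_norm_sq f) σ

theorem integral_norm_sq (f : OneParticle) : ∫ x, ‖f x‖ ^ 2 ∂spinMeasure = ‖f‖ ^ 2 := by
  have h : inner ℂ f f = ((∫ x, ‖f x‖ ^ 2 ∂spinMeasure : ℝ) : ℂ) := by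
    rw [L2.inner_def, ← integral_complex_ofReal]
    simp_rw [inner_self_eq_norm_sq_to_K]
    simp
  rw [inner_self_eq_norm_sq_to_K] at h
  exact Complex.ofReal_injective (by rw [← h]; simp)

theorem integral_norm_sq_slice_le (f : OneParticle) (σ : Fin 2) :
    ∫ x : Space, ‖f (x, σ)‖ ^ 2 ≤ ‖f‖ ^ 2 := by
  rw [← integral_norm_sq, integral_spin (integrable_norm_sq f)]
  exact Finset.single_le_sum (f := fun σ => ∫ x : Space, ‖f (x, σ)‖ ^ 2)
    (fun _ _ => integral_nonneg fun _ => by positivity) (Finset.mem_univ σ)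

end Spin

/-! ### The resolvent of the Laplacian and the sup bound on its domain -/

section Laplacian

open Real FourierTransform

/-- The Cauchy–Schwarz inequality for integrals. -/
theorem norm_integral_mul_sq_le {α : Type*} [MeasurableSpace α] {μ : Measure α} {f g : α → ℂ}
    (hf : MemLp f 2 μ) (hg : MemLp g 2 μ) :
    ‖∫ x, f x * g x ∂μ‖ ^ 2 ≤ (∫ x, ‖f x‖ ^ 2 ∂μ) * ∫ x, ‖g x‖ ^ 2 ∂μ := by
  have h := integral_mul_norm_le_Lp_mul_Lq (μ := μ) (f := f) (g := g) Real.HolderConjugate.two_two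
    (by simpa using hf) (by simpa using hg)
  have h2 : ‖∫ x, f x * g x ∂μ‖ ≤ ∫ x, ‖f x‖ * ‖g x‖ ∂μ := by
    simpa using norm_integral_le_integral_norm (μ := μ) fun x => f x * g x
  have h3 := h2.trans h
  simp only [Real.rpow_two] at h3
  rw [← Real.sqrt_eq_rpow, ← Real.sqrt_eq_rpow] at h3
  calc _ ≤ _ := pow_le_pow_left₀ (norm_nonneg _) h3 2
    _ = _ := by
      rw [mul_pow, Real.sq_sqrt (integral_nonneg fun _ => by positivity),
        Real.sq_sqrt (integral_nonneg fun _ => by positivity)]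

theorem norm_fourier_le_integral (ψ : 𝓢(Space, ℂ)) (p : Space) : ‖𝓕 ψ p‖ ≤ ∫ x, ‖ψ x‖ := by
  rw [SchwartzMap.fourier_coe]
  exact VectorFourier.norm_fourierIntegral_le_integral_norm _ _ _ _ _

/-- The symbol `(1 + |2πp|²)⁻¹` of the resolvent `(1 - Δ)⁻¹`. -/
def resolventSymbol (p : Space) : ℝ := (1 + ‖(2 * π) • p‖ ^ 2) ^ (-1 : ℝ)

theorem hasTemperateGrowth_resolventSymbol : resolventSymbol.HasTemperateGrowth := by
  have h1 : (fun p : Space => (1 + ‖p‖ ^ 2) ^ (-1 : ℝ)).HasTemperateGrowth := by fun_prop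
  have h2 : (fun p : Space => (2 * π) • p).HasTemperateGrowth := by fun_prop
  exact h1.comp h2

/-- The square decays like `|p|⁻⁴`, and `4` exceeds the dimension `3`. -/
theorem integrable_resolventSymbol_sq : Integrable fun p => resolventSymbol p ^ 2 := by
  have h := integrable_rpow_neg_one_add_norm_sq (E := Space) (μ := volume) (r := 4)
    (by simp; norm_num)
  have h2 := h.comp_smul (R := 2 * π) (by positivity)
  refine h2.congr (Filter.Eventually.of_forall fun p => ?_)
  simp only [resolventSymbol]
  rw [← Real.rpow_mul_natCast (by positivity)]
  norm_num

theorem resolventSymbol_mul (p : Space) :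
    resolventSymbol p * (1 + (2 * π) ^ 2 * ‖p‖ ^ 2) = 1 := by
  rw [resolventSymbol, Real.rpow_neg_one, norm_smul, mul_pow, Real.norm_eq_abs, sq_abs]
  exact inv_mul_cancel₀ (by positivity)

/-- The resolvent `(1 - Δ)⁻¹` maps Schwartz functions to Schwartz functions and is bounded from
`L¹` to `L²`. -/
theorem exists_schwartz_resolvent : ∃ C : ℝ, 0 ≤ C ∧ ∀ ψ : 𝓢(Space, ℂ), ∃ φ : 𝓢(Space, ℂ),
    φ - Δ φ = ψ ∧ ∫ x, ‖φ x‖ ^ 2 ≤ C * (∫ x, ‖ψ x‖) ^ 2 := by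
  -- The `L²` bound, with this constant, is Plancherel combined with `|𝓕 ψ| ≤ ‖ψ‖₁`. The equation is
  -- checked on the Fourier side, where `1 - Δ` multiplies by the inverse of the symbol.
  refine ⟨∫ p, resolventSymbol p ^ 2, integral_nonneg fun _ => by positivity, fun ψ =>
    ⟨𝓕⁻ (SchwartzMap.smulLeftCLM ℂ resolventSymbol (𝓕 ψ)), ?_, ?_⟩⟩
  · have hinj : Function.Injective (𝓕 : 𝓢(Space, ℂ) → 𝓢(Space, ℂ)) := fun a b h => by
      have := congrArg (𝓕⁻ : 𝓢(Space, ℂ) → 𝓢(Space, ℂ)) h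
      simpa using this
    apply hinj
    rw [SchwartzMap.laplacian_eq_fourierMultiplierCLM, SchwartzMap.fourierMultiplierCLM_apply,
      neg_smul, sub_neg_eq_add,
      FourierTransform.fourier_add, FourierTransform.fourier_smul]
    simp only [FourierTransform.fourier_fourierInv_eq]
    ext p
    simp only [add_apply, smul_apply]
    rw [SchwartzMap.smulLeftCLM_apply_apply
        (show (fun x : Space => ‖x‖ ^ 2).HasTemperateGrowth by fun_prop),
      SchwartzMap.smulLeftCLM_apply_apply hasTemperateGrowth_resolventSymbol]
    simp only [Complex.real_smul]
    have := resolventSymbol_mul p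
    have h2 : (resolventSymbol p : ℂ) * (1 + (2 * π) ^ 2 * (‖p‖ : ℂ) ^ 2) = 1 := by
      exact_mod_cast this
    push_cast
    linear_combination (𝓕 ψ p) * h2
  · rw [← SchwartzMap.integral_norm_sq_fourier]
    simp only [FourierTransform.fourier_fourierInv_eq]
    rw [← integral_mul_const]
    refine integral_mono_of_nonneg (Filter.Eventually.of_forall fun _ => by positivity)
      (integrable_resolventSymbol_sq.mul_const _) (Filter.Eventually.of_forall fun p => ?_)
    simp only
    rw [SchwartzMap.smulLeftCLM_apply_apply hasTemperateGrowth_resolventSymbol, norm_smul, mul_pow,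
      Real.norm_eq_abs, sq_abs]
    gcongr
    exact norm_fourier_le_integral ψ p

/-- A locally integrable function with `|∫ u φ| ≤ M ‖φ‖₁` for all test functions is bounded
by `M`. -/
theorem ae_norm_le_of_forall_schwartz {u : Space → ℂ} (hu : LocallyIntegrable u) {M : ℝ}
    (h : ∀ φ : 𝓢(Space, ℂ), ‖∫ x, u x * φ x‖ ≤ M * ∫ x, ‖φ x‖) : ∀ᵐ x, ‖u x‖ ≤ M := by
  -- Convolutions with shrinking normalized bumps converge to `u` almost everywhere, and each is a
  -- test integral with `‖φ‖₁ = 1`. The fixed ratio of the radii is what the differentiation theorem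
  -- requires.
  let φ : ℕ → ContDiffBump (0 : Space) := fun n =>
    ⟨1 / (n + 1), 2 / (n + 1), by positivity, by gcongr; norm_num⟩
  have hlim : Filter.Tendsto (fun n => (φ n).rOut) Filter.atTop (nhds 0) := by
    simpa [φ, div_eq_mul_inv] using
      (tendsto_one_div_add_atTop_nhds_zero_nat (𝕜 := ℝ)).const_mul 2
  have hK : ∀ᶠ n in Filter.atTop, (φ n).rOut ≤ 2 * (φ n).rIn :=
    Filter.Eventually.of_forall fun n => le_of_eq (by simp only [φ]; ring)
  filter_upwards [ContDiffBump.ae_convolution_tendsto_right_of_locallyIntegrable hlim hK hu]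
    with x hx
  refine le_of_tendsto hx.norm (Filter.Eventually.of_forall fun n => ?_)
  let g : Space → ℂ := fun y => ((φ n).normed volume (x - y) : ℂ)
  have hg1 : HasCompactSupport g := by
    have : HasCompactSupport fun y => (φ n).normed volume (x - y) :=
      (φ n).hasCompactSupport_normed.comp_homeomorph (Homeomorph.subLeft x)
    exact this.comp_left (g := fun r : ℝ => (r : ℂ)) Complex.ofReal_zero
  have hg2 : ContDiff ℝ (⊤ : ℕ∞) g :=
    Complex.ofRealCLM.contDiff.comp ((φ n).contDiff_normed.comp (contDiff_const.sub contDiff_id))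
  have key := h (hg1.toSchwartzMap hg2)
  have h1 : ∫ y, ‖(hg1.toSchwartzMap hg2) y‖ = 1 := by
    simp only [HasCompactSupport.toSchwartzMap_toFun, g, Complex.norm_real, Real.norm_eq_abs,
      abs_of_nonneg ((φ n).nonneg_normed _)]
    rw [integral_sub_left_eq_self (fun y => (φ n).normed volume y)]
    exact (φ n).integral_normed
  rw [h1, mul_one] at key
  rw [convolution_eq_swap]
  refine (congrArg norm (integral_congr_ae (Filter.Eventually.of_forall fun y => ?_))).trans_le key
  simp [g, mul_comm]

theorem integrable_mul_schwartz {u : Space → ℂ} (hu : MemLp u 2) (φ : 𝓢(Space, ℂ)) :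
    Integrable fun x => u x * φ x :=
  hu.integrable_mul (q := 2) (φ.memLp 2)

/-- Functions in the domain of the Laplacian on `L²(ℝ³)` are bounded. -/
theorem exists_sup_bound : ∃ C : ℝ, 0 ≤ C ∧ ∀ u w : OneParticle, HasNegLaplacian u w →
    ∀ᵐ x ∂spinMeasure, ‖u x‖ ≤ C * ‖w + u‖ := by
  obtain ⟨C, hC, hres⟩ := exists_schwartz_resolvent
  refine ⟨√C, by positivity, fun u w h => ae_spin_iff.2 fun σ => ?_⟩
  refine ae_norm_le_of_forall_schwartz ((memLp_slice u σ).locallyIntegrable (by norm_num))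
    fun ψ => ?_
  -- Duality: every test function is `ψ = (1-Δ)φ`, hence `|∫ u ψ| = |∫ (w+u) φ| ≤ ‖w+u‖ ‖φ‖₂ ≤ √C
  -- ‖w+u‖ ‖ψ‖₁`.
  obtain ⟨φ, rfl, hφ⟩ := hres ψ
  set ψ := φ - Δ φ with hψ
  have hadd : ∀ᵐ x : Space, (w + u) (x, σ) = w (x, σ) + u (x, σ) :=
    ae_spin_iff.1 (Lp.coeFn_add w u) σ
  have h1 : ∫ x : Space, u (x, σ) * ψ x = ∫ x : Space, (w + u) (x, σ) * φ x := by
    have e1 : ∀ x : Space, u (x, σ) * ψ x = u (x, σ) * φ x - u (x, σ) * (Δ φ) x := fun x => by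
      rw [hψ, sub_apply, mul_sub]
    simp_rw [e1]
    rw [integral_sub (integrable_mul_schwartz (memLp_slice u σ) φ)
      (integrable_mul_schwartz (memLp_slice u σ) _), sub_eq_add_neg, ← h σ φ,
      ← integral_add (integrable_mul_schwartz (memLp_slice u σ) φ)
        (integrable_mul_schwartz (memLp_slice w σ) φ)]
    refine integral_congr_ae (hadd.mono fun x hx => ?_)
    simp only [hx]
    ring
  rw [h1]
  refine le_of_sq_le_sq ?_ (mul_nonneg (by positivity) (integral_nonneg fun _ => norm_nonneg _))
  calc _ ≤ (∫ x : Space, ‖(w + u) (x, σ)‖ ^ 2) * ∫ x, ‖φ x‖ ^ 2 :=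
        norm_integral_mul_sq_le (memLp_slice _ σ) (φ.memLp 2)
    _ ≤ ‖w + u‖ ^ 2 * (C * (∫ x, ‖ψ x‖) ^ 2) := by
        gcongr
        exact integral_norm_sq_slice_le _ σ
    _ = _ := by
        rw [mul_pow, mul_pow, Real.sq_sqrt hC]
        ring

/-- The difference of two candidates integrates to zero against every test function, so the sup
bound applies with `M = 0`. -/
theorem HasNegLaplacian.unique {u w w' : OneParticle} (h : HasNegLaplacian u w)
    (h' : HasNegLaplacian u w') : w = w' := by
  refine Lp.ext (ae_spin_iff.2 fun σ => ?_)
  have hs := (memLp_slice w σ).sub (memLp_slice w' σ)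
  have : ∀ᵐ x : Space, ‖w (x, σ) - w' (x, σ)‖ ≤ 0 := by
    refine ae_norm_le_of_forall_schwartz (u := fun x => w (x, σ) - w' (x, σ)) (hs.locallyIntegrable (by norm_num)) fun φ => ?_
    simp only [sub_mul]
    rw [integral_sub (integrable_mul_schwartz (memLp_slice w σ) φ)
      (integrable_mul_schwartz (memLp_slice w' σ) φ), h σ φ, h' σ φ]
    simp
  filter_upwards [this] with x hx
  exact sub_eq_zero.1 (norm_le_zero_iff.1 hx)

theorem HasNegLaplacian.add {u u' w w' : OneParticle} (h : HasNegLaplacian u w)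
    (h' : HasNegLaplacian u' w') : HasNegLaplacian (u + u') (w + w') := by
  intro σ φ
  have e : ∀ a b : OneParticle, ∀ ψ : 𝓢(Space, ℂ), ∫ x : Space, (a + b) (x, σ) * ψ x
      = (∫ x : Space, a (x, σ) * ψ x) + ∫ x : Space, b (x, σ) * ψ x := fun a b ψ => by
    rw [← integral_add (integrable_mul_schwartz (memLp_slice a σ) ψ)
        (integrable_mul_schwartz (memLp_slice b σ) ψ)]
    refine integral_congr_ae ((ae_spin_iff.1 (Lp.coeFn_add a b) σ).mono fun x hx => ?_)
    simp only [hx, Pi.add_apply, add_mul]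
  rw [e, e, h σ φ, h' σ φ, neg_add]

theorem HasNegLaplacian.smul {u w : OneParticle} (c : ℂ) (h : HasNegLaplacian u w) :
    HasNegLaplacian (c • u) (c • w) := by
  intro σ φ
  have e : ∀ a : OneParticle, ∀ ψ : 𝓢(Space, ℂ), ∫ x : Space, (c • a) (x, σ) * ψ x
      = c * ∫ x : Space, a (x, σ) * ψ x := fun a ψ => by
    rw [← integral_const_mul]
    refine integral_congr_ae ((ae_spin_iff.1 (Lp.coeFn_smul c a) σ).mono fun x hx => ?_)
    simp only [hx, Pi.smul_apply, smul_eq_mul, mul_assoc]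
  rw [e, e, h σ φ, mul_neg]

theorem IsNegLaplacianMul.add {γ γ' S S' : OneParticle →L[ℂ] OneParticle}
    (h : IsNegLaplacianMul γ S) (h' : IsNegLaplacianMul γ' S') :
    IsNegLaplacianMul (γ + γ') (S + S') := fun f => (h f).add (h' f)

theorem IsNegLaplacianMul.smul {γ S : OneParticle →L[ℂ] OneParticle} (c : ℂ)
    (h : IsNegLaplacianMul γ S) : IsNegLaplacianMul (c • γ) (c • S) := fun f => (h f).smul c

theorem IsNegLaplacianMul.eq {γ S : OneParticle →L[ℂ] OneParticle} (h : IsNegLaplacianMul γ S) :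
    negLaplacianMul γ = S := by
  have hex : ∃ S, IsNegLaplacianMul γ S := ⟨S, h⟩
  rw [negLaplacianMul, dif_pos hex]
  ext1 f
  exact (hex.choose_spec f).unique (h f)

end Laplacian

/-! ### Series of integrable functions and multiplication operators -/

section Integration

/-- A series of integrable functions whose `L¹` norms are summable converges absolutely almost
everywhere to an integrable function. -/
theorem integrable_tsum {α ι E : Type*} [MeasurableSpace α] {μ : Measure α} [Countable ι]
    [NormedAddCommGroup E] [CompleteSpace E] {F : ι → α → E}
    (hF : ∀ i, Integrable (F i) μ) (hs : Summable fun i => ∫ a, ‖F i a‖ ∂μ) :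
    (∀ᵐ a ∂μ, Summable fun i => ‖F i a‖) ∧ Integrable (fun a => ∑' i, F i a) μ := by
  have hlt : ∫⁻ a, ∑' i, ‖F i a‖ₑ ∂μ < ⊤ := by
    rw [lintegral_tsum fun i => (hF i).1.enorm]
    simp_rw [← ofReal_integral_norm_eq_lintegral_enorm (hF _)]
    rw [← ENNReal.ofReal_tsum_of_nonneg (fun i => integral_nonneg fun _ => norm_nonneg _) hs]
    exact ENNReal.ofReal_lt_top
  have hae : ∀ᵐ a ∂μ, Summable fun i => ‖F i a‖ := by
    filter_upwards [ae_lt_top' (AEMeasurable.tsum fun i => (hF i).1.enorm) hlt.ne]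
      with a ha
    have := ENNReal.tsum_coe_ne_top_iff_summable.1 ha.ne
    simpa using NNReal.summable_coe.2 this
  refine ⟨hae, ?_, ?_⟩
  · refine aestronglyMeasurable_of_tendsto_ae (Filter.atTop : Filter (Finset ι))
      (f := fun s a => ∑ i ∈ s, F i a) (fun s => ?_) ?_
    · exact Finset.aestronglyMeasurable_fun_sum s fun i _ => (hF i).1
    · filter_upwards [hae] with a ha
      exact ha.of_norm.hasSum
  · refine lt_of_le_of_lt (lintegral_mono_ae ?_) hlt
    filter_upwards [hae] with a ha
    exact enorm_tsum_le_tsum_enorm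

/-- If a series converges in `Lᵖ` and pointwise almost everywhere, the limits agree. -/
theorem hasSum_Lp_ae_eq {α ι : Type*} [MeasurableSpace α] {μ : Measure α} [Countable ι]
    {p : ENNReal} [Fact (1 ≤ p)]
    {F : ι → Lp ℂ p μ} {G : Lp ℂ p μ} (h : HasSum F G) {g : α → ℂ}
    (hg : ∀ᵐ a ∂μ, HasSum (fun i => F i a) (g a)) : ∀ᵐ a ∂μ, G a = g a := by
  -- Convergence in norm gives convergence in measure, hence almost everywhere convergence along a
  -- sequence of finite partial sums exhausting the index set.
  obtain ⟨ns, h1, h2⟩ := (tendstoInMeasure_of_tendsto_Lp h).exists_seq_tendsto_ae'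
  have h3 : ∀ᵐ a ∂μ, ∀ s : Finset ι, (∑ i ∈ s, F i : Lp ℂ p μ) a = ∑ i ∈ s, F i a :=
    ae_all_iff.2 fun s => Lp.coeFn_fun_finsetSum s F
  filter_upwards [h2, hg, h3] with a ha hga h3a
  refine tendsto_nhds_unique ha ?_
  simp_rw [h3a]
  exact hga.comp h1

theorem inner_eq_integral (f g : OneParticle) :
    inner ℂ f g = ∫ x, (starRingEnd ℂ) (f x) * g x ∂spinMeasure := by
  rw [L2.inner_def]
  simp [RCLike.inner_apply, mul_comm]

theorem integral_norm_mul_norm_le (f g : OneParticle) :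
    ∫ x, ‖f x‖ * ‖g x‖ ∂spinMeasure ≤ ‖f‖ * ‖g‖ := by
  refine le_of_sq_le_sq ?_ (by positivity)
  have h := norm_integral_mul_sq_le (μ := spinMeasure) (f := fun x => (‖f x‖ : ℂ))
    (g := fun x => (‖g x‖ : ℂ)) (Lp.memLp f).norm.ofReal (Lp.memLp g).norm.ofReal
  simp only [Complex.norm_real, norm_norm, integral_norm_sq] at h
  rw [mul_pow]
  have e : ‖∫ x, (‖f x‖ : ℂ) * (‖g x‖ : ℂ) ∂spinMeasure‖
      = ∫ x, ‖f x‖ * ‖g x‖ ∂spinMeasure := by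
    simp_rw [← Complex.ofReal_mul]
    rw [integral_complex_ofReal, Complex.norm_real,
      Real.norm_of_nonneg (integral_nonneg fun x => by positivity)]
  rwa [e] at h

/-- Multiplication by a bounded measurable function is a bounded operator on `L²(Γ)`. -/
theorem exists_mulOperator {W : SpinSpace → ℝ} (hW : Measurable W) {M : ℝ} (hM : ∀ p, |W p| ≤ M) :
    ∃ A : OneParticle →L[ℂ] OneParticle,
      ∀ f : OneParticle, ∀ᵐ p ∂spinMeasure, A f p = W p * f p := by
  have hmem : MemLp (fun p => (W p : ℂ)) ⊤ spinMeasure :=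
    memLp_top_of_bound (Complex.measurable_ofReal.comp hW).aestronglyMeasurable M
      (Filter.Eventually.of_forall fun p => by simpa using hM p)
  refine ⟨(ContinuousLinearMap.mul ℂ ℂ).holderL spinMeasure ⊤ 2 2 (hmem.toLp), fun f => ?_⟩
  filter_upwards [(ContinuousLinearMap.mul ℂ ℂ).coeFn_holder (r := 2) hmem.toLp f,
    hmem.coeFn_toLp] with p h1 h2
  rw [ContinuousLinearMap.holderL_apply_apply, h1, h2]
  rfl

end Integration

/-- Separability makes eigenbases countable and supplies the dense sequence used to test integral
kernels. -/
instance : SecondCountableTopology OneParticle :=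
  have : Fact ((2 : ENNReal) ≠ ⊤) := ⟨ENNReal.ofNat_ne_top⟩
  inferInstance

/-! ### Natural orbitals, the density and the integral kernel -/

section Orbitals

variable {γ : OneParticle →L[ℂ] OneParticle}

instance (o : NaturalOrbitals γ) : Countable o.index := o.countable_index

theorem exists_naturalOrbitals (ht : IsTraceClass γ) (h0 : 0 ≤ γ) :
    Nonempty (NaturalOrbitals γ) := by
  have hpos := (ContinuousLinearMap.nonneg_iff_isPositive γ).1 h0
  obtain ⟨ι, b, μ, h⟩ := exists_hilbertBasis_eigenvectors ht.isCompactOperator hpos.isSymmetric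
  exact ⟨⟨ι, countable_of_orthonormal b.orthonormal, b, μ, h⟩⟩

namespace NaturalOrbitals

variable (o : NaturalOrbitals γ)

theorem inner_apply (n : o.index) :
    inner ℂ (o.orbital n) (γ (o.orbital n)) = (o.occupation n : ℂ) := by
  rw [o.eigen, inner_smul_right, inner_self_eq_norm_sq_to_K, o.orbital.orthonormal.1]
  simp

theorem occupation_nonneg (h0 : 0 ≤ γ) (n : o.index) : 0 ≤ o.occupation n := by
  have := ((ContinuousLinearMap.nonneg_iff_isPositive γ).1 h0).re_inner_nonneg_right (o.orbital n)
  rw [o.inner_apply] at this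
  simpa using this

theorem occupation_le_one (h1 : γ ≤ 1) (n : o.index) : o.occupation n ≤ 1 := by
  have := ((ContinuousLinearMap.le_def γ 1).1 h1).re_inner_nonneg_right (o.orbital n)
  rw [sub_apply, inner_sub_right, o.inner_apply, one_apply_eq_self,
    inner_self_eq_norm_sq_to_K, o.orbital.orthonormal.1] at this
  simpa using this

theorem hasSum_occupation (ht : IsTraceClass γ) :
    HasSum (fun n => (o.occupation n : ℂ)) (trace γ) := by
  simpa [o.inner_apply] using ht.hasSum_trace o.orbital

theorem summable_occupation (ht : IsTraceClass γ) : Summable o.occupation := by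
  simpa using (o.hasSum_occupation ht).summable.mapL Complex.reCLM

theorem hasSum_apply (f : OneParticle) :
    HasSum (fun n => ((o.occupation n : ℂ) * inner ℂ (o.orbital n) f) • o.orbital n) (γ f) := by
  convert (o.orbital.hasSum_repr f).mapL γ using 2 with n
  rw [HilbertBasis.repr_apply_apply, map_smul, o.eigen, smul_smul, mul_comm]

/-- The spin-resolved density `∑ₙ λₙ |ξₙ(x)|²`. -/
def spinDensity (p : SpinSpace) : ℝ := ∑' n, o.occupation n * ‖o.orbital n p‖ ^ 2

theorem spinDensity_nonneg (h0 : 0 ≤ γ) (p : SpinSpace) : 0 ≤ o.spinDensity p :=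
  tsum_nonneg fun n => mul_nonneg (o.occupation_nonneg h0 n) (by positivity)

theorem integral_norm_sq_orbital (n : o.index) :
    ∫ p, ‖o.orbital n p‖ ^ 2 ∂spinMeasure = 1 := by
  rw [integral_norm_sq, o.orbital.orthonormal.1, one_pow]

theorem integrable_weight_mul {W : SpinSpace → ℝ} (hW : Measurable W) {M : ℝ}
    (hM : ∀ p, |W p| ≤ M) (n : o.index) :
    Integrable (fun p => W p * (o.occupation n * ‖o.orbital n p‖ ^ 2)) spinMeasure := by
  refine ((integrable_norm_sq (o.orbital n)).const_mul _).bdd_mul (c := M) hW.aestronglyMeasurable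
    (Filter.Eventually.of_forall hM)

theorem summable_integral_weight_mul (ht : IsTraceClass γ) (h0 : 0 ≤ γ) {W : SpinSpace → ℝ}
    {M : ℝ} (hM : ∀ p, |W p| ≤ M) :
    Summable fun n => ∫ p, ‖W p * (o.occupation n * ‖o.orbital n p‖ ^ 2)‖ ∂spinMeasure := by
  refine Summable.of_nonneg_of_le (fun _ => integral_nonneg fun _ => norm_nonneg _) (fun n => ?_)
    ((o.summable_occupation ht).mul_left M)
  have h1 := o.occupation_nonneg h0 n
  calc _ ≤ ∫ p, M * (o.occupation n * ‖o.orbital n p‖ ^ 2) ∂spinMeasure := by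
        refine integral_mono_of_nonneg (Filter.Eventually.of_forall fun _ => norm_nonneg _)
          (((integrable_norm_sq _).const_mul _).const_mul _)
          (Filter.Eventually.of_forall fun p => ?_)
        simp only [norm_mul, Real.norm_eq_abs, abs_of_nonneg h1, abs_pow, abs_norm]
        gcongr
        exact hM p
    _ = _ := by rw [integral_const_mul, integral_const_mul, o.integral_norm_sq_orbital, mul_one]

theorem ae_summable (ht : IsTraceClass γ) (h0 : 0 ≤ γ) :
    ∀ᵐ p ∂spinMeasure, Summable fun n => o.occupation n * ‖o.orbital n p‖ ^ 2 := by
  have := (integrable_tsum (o.integrable_weight_mul (W := fun _ => 1) measurable_const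
    (M := 1) (by simp)) (o.summable_integral_weight_mul ht h0 (M := 1) (by simp))).1
  filter_upwards [this] with p hp
  simpa using hp.of_norm

theorem integrable_spinDensity (ht : IsTraceClass γ) (h0 : 0 ≤ γ) :
    Integrable o.spinDensity spinMeasure := by
  have := (integrable_tsum (o.integrable_weight_mul (W := fun _ => 1) measurable_const
    (M := 1) (by simp)) (o.summable_integral_weight_mul ht h0 (M := 1) (by simp))).2
  simp only [one_mul] at this
  exact this

/-- The density represents `A ↦ tr(A γ)` for multiplication operators `A`. -/
theorem integral_mul_spinDensity (ht : IsTraceClass γ) (h0 : 0 ≤ γ) {W : SpinSpace → ℝ}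
    (hW : Measurable W) {M : ℝ} (hM : ∀ p, |W p| ≤ M) {A : OneParticle →L[ℂ] OneParticle}
    (hA : ∀ f : OneParticle, ∀ᵐ p ∂spinMeasure, A f p = W p * f p) :
    ((∫ p, W p * o.spinDensity p ∂spinMeasure : ℝ) : ℂ) = trace (A ∘L γ) := by
  have h1 := hasSum_integral_of_summable_integral_norm (o.integrable_weight_mul hW hM)
    (o.summable_integral_weight_mul ht h0 hM)
  simp_rw [tsum_mul_left] at h1
  have h2 := h1.mapL Complex.ofRealCLM
  refine h2.unique ?_
  convert (ht.comp_left A).hasSum_trace o.orbital with n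
  rw [ContinuousLinearMap.comp_apply, o.eigen, map_smul, inner_smul_right, inner_eq_integral,
    Complex.ofRealCLM_apply, ← integral_complex_ofReal, ← integral_const_mul]
  refine integral_congr_ae ?_
  filter_upwards [hA (o.orbital n)] with p hp
  rw [hp]
  push_cast
  rw [← Complex.conj_mul']
  ring

/-- The density does not depend on the choice of natural orbitals. -/
theorem spinDensity_ae_eq (ht : IsTraceClass γ) (h0 : 0 ≤ γ) (o' : NaturalOrbitals γ) :
    o.spinDensity =ᵐ[spinMeasure] o'.spinDensity := by
  refine Integrable.ae_eq_of_forall_setIntegral_eq _ _ (o.integrable_spinDensity ht h0)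
    (o'.integrable_spinDensity ht h0) fun s hs _ => ?_
  -- The integral of the density over `s` is the trace of `γ` followed by multiplication with the
  -- indicator of `s`, which involves no choice of orbitals.
  have hW : Measurable (s.indicator fun _ => (1 : ℝ)) := measurable_const.indicator hs
  have hM : ∀ p, |s.indicator (fun _ => (1 : ℝ)) p| ≤ 1 := fun p => by
    by_cases h : p ∈ s <;> simp [h]
  obtain ⟨A, hA⟩ := exists_mulOperator hW hM
  have key := (o.integral_mul_spinDensity ht h0 hW hM hA).trans
    (o'.integral_mul_spinDensity ht h0 hW hM hA).symm
  rw [← integral_indicator hs, ← integral_indicator hs]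
  have e : ∀ g : SpinSpace → ℝ, s.indicator g = fun p => s.indicator (fun _ => (1 : ℝ)) p * g p :=
    fun g => by
      ext p
      by_cases h : p ∈ s <;> simp [h]
  rw [e o.spinDensity, e o'.spinDensity]
  exact Complex.ofReal_injective key

/-- The integral kernel `∑ₙ λₙ ξₙ(x) ξₙ(y)*`. -/
def kernelSum (z : SpinSpace × SpinSpace) : ℂ :=
  ∑' n, (o.occupation n : ℂ) * (o.orbital n z.1 * (starRingEnd ℂ) (o.orbital n z.2))

/-- Pointwise absolute convergence and Cauchy–Schwarz bound of the kernel expansion. -/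
theorem summable_kernelSum (h0 : 0 ≤ γ) {p q : SpinSpace}
    (hp : Summable fun n => o.occupation n * ‖o.orbital n p‖ ^ 2)
    (hq : Summable fun n => o.occupation n * ‖o.orbital n q‖ ^ 2) :
    Summable (fun n => (o.occupation n : ℂ) *
      (o.orbital n p * (starRingEnd ℂ) (o.orbital n q))) ∧
    ‖o.kernelSum (p, q)‖ ^ 2 ≤ o.spinDensity p * o.spinDensity q := by
  let a : SpinSpace → o.index → ℝ := fun p n => √(o.occupation n) * ‖o.orbital n p‖
  have ha2 : ∀ p n, a p n ^ 2 = o.occupation n * ‖o.orbital n p‖ ^ 2 := fun p n => by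
    simp only [a, mul_pow, Real.sq_sqrt (o.occupation_nonneg h0 n)]
  have hnorm : ∀ n, ‖(o.occupation n : ℂ) * (o.orbital n p * (starRingEnd ℂ) (o.orbital n q))‖
      = a p n * a q n := fun n => by
    have h := o.occupation_nonneg h0 n
    simp only [norm_mul, Complex.norm_real, Real.norm_eq_abs, abs_of_nonneg h, RCLike.norm_conj, a]
    nth_rewrite 1 [← Real.mul_self_sqrt h]
    ring
  have hs : Summable fun n => a p n * a q n := by
    refine Summable.of_nonneg_of_le (fun n => by positivity) (fun n => ?_) (hp.add hq)
    rw [← ha2, ← ha2]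
    nlinarith [sq_nonneg (a p n - a q n), sq_nonneg (a p n), sq_nonneg (a q n)]
  have hs' : Summable fun n => ‖(o.occupation n : ℂ) *
      (o.orbital n p * (starRingEnd ℂ) (o.orbital n q))‖ := by
    simpa only [hnorm] using hs
  refine ⟨hs'.of_norm, ?_⟩
  have h1 : ‖o.kernelSum (p, q)‖ ≤ ∑' n, a p n * a q n := by
    refine (norm_tsum_le_tsum_norm hs').trans (le_of_eq ?_)
    simp only [hnorm]
  have h2 := Real.inner_le_Lp_mul_Lq_tsum_of_nonneg Real.HolderConjugate.two_two
    (f := a p) (g := a q) (fun n => by positivity) (fun n => by positivity)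
    (by simpa only [Real.rpow_two, ha2] using hp) (by simpa only [Real.rpow_two, ha2] using hq)
  simp only [Real.rpow_two, ha2, ← Real.sqrt_eq_rpow] at h2
  refine (pow_le_pow_left₀ (norm_nonneg _) (h1.trans h2) 2).trans (le_of_eq ?_)
  rw [mul_pow, Real.sq_sqrt, Real.sq_sqrt]
  · rfl
  · exact o.spinDensity_nonneg h0 q
  · exact o.spinDensity_nonneg h0 p

theorem ae_prod_summable (ht : IsTraceClass γ) (h0 : 0 ≤ γ) :
    ∀ᵐ z ∂spinMeasure.prod spinMeasure,
      (Summable fun n => o.occupation n * ‖o.orbital n z.1‖ ^ 2) ∧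
      Summable fun n => o.occupation n * ‖o.orbital n z.2‖ ^ 2 :=
  (Measure.quasiMeasurePreserving_fst.ae (o.ae_summable ht h0)).and
    (Measure.quasiMeasurePreserving_snd.ae (o.ae_summable ht h0))

theorem aestronglyMeasurable_kernelSum (ht : IsTraceClass γ) (h0 : 0 ≤ γ) :
    AEStronglyMeasurable o.kernelSum (spinMeasure.prod spinMeasure) := by
  refine aestronglyMeasurable_of_tendsto_ae (Filter.atTop : Filter (Finset o.index))
    (f := fun s z => ∑ n ∈ s, (o.occupation n : ℂ) *
      (o.orbital n z.1 * (starRingEnd ℂ) (o.orbital n z.2))) (fun s => ?_) ?_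
  · refine Finset.aestronglyMeasurable_fun_sum s fun n _ => ?_
    have hm := Lp.stronglyMeasurable (o.orbital n)
    exact (((hm.comp_measurable measurable_fst).mul
      (Complex.continuous_conj.comp_stronglyMeasurable
        (hm.comp_measurable measurable_snd))).const_mul _).aestronglyMeasurable
  · filter_upwards [o.ae_prod_summable ht h0] with z hz
    exact (o.summable_kernelSum h0 hz.1 hz.2).1.hasSum

/-- Square integrability comes from `|γ(x,y)|² ≤ ρ(x)ρ(y)`. For the action on `f`, the eigenvector
expansion of `γ f` in `L²` is matched with the pointwise one after exchanging sum and integral. -/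
theorem isIntegralKernel_kernelSum (ht : IsTraceClass γ) (h0 : 0 ≤ γ) :
    IsIntegralKernel γ o.kernelSum := by
  have hmeas := o.aestronglyMeasurable_kernelSum ht h0
  constructor
  · refine (memLp_two_iff_integrable_sq_norm hmeas).2 ?_
    have hint := (o.integrable_spinDensity ht h0).mul_prod (o.integrable_spinDensity ht h0)
    refine hint.mono' (hmeas.norm.pow 2) ?_
    filter_upwards [o.ae_prod_summable ht h0] with z hz
    simpa using (o.summable_kernelSum h0 hz.1 hz.2).2
  · intro f
    refine hasSum_Lp_ae_eq (o.hasSum_apply f) ?_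
    have hcoe : ∀ᵐ p ∂spinMeasure, ∀ n, (((o.occupation n : ℂ) * inner ℂ (o.orbital n) f) •
        o.orbital n : OneParticle) p
          = ((o.occupation n : ℂ) * inner ℂ (o.orbital n) f) * o.orbital n p :=
      ae_all_iff.2 fun n => Lp.coeFn_smul _ _
    filter_upwards [o.ae_summable ht h0, hcoe] with p hp hcp
    let F : o.index → SpinSpace → ℂ := fun n q =>
      (o.occupation n * o.orbital n p) * ((starRingEnd ℂ) (o.orbital n q) * f q)
    have hF : ∀ n, Integrable (F n) spinMeasure := fun n => by
      refine Integrable.const_mul ?_ _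
      exact (Lp.memLp (o.orbital n)).star.integrable_mul (Lp.memLp f)
    -- The inequality `t ≤ 1 + t²` reduces `λₙ|ξₙ(p)|` to the two summable series `λₙ` and
    -- `λₙ|ξₙ(p)|²`.
    have hFn : ∀ n, ∫ q, ‖F n q‖ ∂spinMeasure
        ≤ (o.occupation n + o.occupation n * ‖o.orbital n p‖ ^ 2) * ‖f‖ := fun n => by
      have h := o.occupation_nonneg h0 n
      simp only [F, norm_mul, RCLike.norm_conj, Complex.norm_real, Real.norm_eq_abs,
        abs_of_nonneg h]
      rw [integral_const_mul]
      have h1 := integral_norm_mul_norm_le (o.orbital n) f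
      rw [o.orbital.orthonormal.1, one_mul] at h1
      calc _ ≤ o.occupation n * ‖o.orbital n p‖ * ‖f‖ := by gcongr
        _ ≤ _ := by
          gcongr
          nlinarith [mul_nonneg h (sq_nonneg (‖o.orbital n p‖ - 1)),
            mul_nonneg h (sq_nonneg ‖o.orbital n p‖)]
    have hsum : Summable fun n => ∫ q, ‖F n q‖ ∂spinMeasure :=
      Summable.of_nonneg_of_le (fun n => integral_nonneg fun _ => norm_nonneg _) hFn
        (((o.summable_occupation ht).add hp).mul_right _)
    have key := hasSum_integral_of_summable_integral_norm hF hsum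
    have e1 : ∀ n, (((o.occupation n : ℂ) * inner ℂ (o.orbital n) f) •
        o.orbital n : OneParticle) p = ∫ q, F n q ∂spinMeasure := fun n => by
      rw [hcp n, integral_const_mul, ← inner_eq_integral]
      ring
    have e2 : ∫ q, o.kernelSum (p, q) * f q ∂spinMeasure
        = ∫ q, ∑' n, F n q ∂spinMeasure := by
      refine integral_congr_ae (Filter.Eventually.of_forall fun q => ?_)
      simp only [kernelSum, F]
      rw [← tsum_mul_right]
      refine tsum_congr fun n => ?_
      ring
    simp_rw [e1]
    rw [e2]
    exact key

end NaturalOrbitals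

/-- The conjugate of `g` is orthogonal to a dense set. Only countably many test functions occur, so
that in the uniqueness of kernels one null set of `x` serves all of them. -/
theorem ae_eq_zero_of_forall_integral_mul {g : SpinSpace → ℂ} (hg : MemLp g 2 spinMeasure)
    (h : ∀ n, ∫ q, g q * TopologicalSpace.denseSeq OneParticle n q ∂spinMeasure = 0) :
    g =ᵐ[spinMeasure] 0 := by
  have hs : MemLp (fun q => (starRingEnd ℂ) (g q)) 2 spinMeasure := hg.star
  have h2 : ∀ f : OneParticle, inner ℂ hs.toLp f = 0 := by
    refine fun f => (TopologicalSpace.denseRange_denseSeq OneParticle).induction_on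
      (p := fun f => inner ℂ hs.toLp f = 0) f
      (isClosed_eq (by fun_prop) continuous_const) fun n => ?_
    rw [inner_eq_integral, ← h n]
    refine integral_congr_ae ?_
    filter_upwards [hs.coeFn_toLp] with q hq
    rw [hq]
    simp
  have h3 : hs.toLp = 0 := inner_self_eq_zero.1 (h2 _)
  filter_upwards [hs.coeFn_toLp, (Lp.eq_zero_iff_ae_eq_zero.1 h3)] with q h4 h5
  rw [h5] at h4
  simpa using h4.symm

/-- The integral kernel is unique up to null sets. -/
theorem IsIntegralKernel.ae_eq {K K' : SpinSpace × SpinSpace → ℂ} (h : IsIntegralKernel γ K)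
    (h' : IsIntegralKernel γ K') : K =ᵐ[spinMeasure.prod spinMeasure] K' := by
  have hslice : ∀ {K : SpinSpace × SpinSpace → ℂ}, MemLp K 2 (spinMeasure.prod spinMeasure) →
      ∀ᵐ p ∂spinMeasure, MemLp (fun q => K (p, q)) 2 spinMeasure := fun {K} hK => by
    filter_upwards [hK.1.prodMk_left,
      ((memLp_two_iff_integrable_sq_norm hK.1).1 hK).prod_right_ae] with p h1 h2
    exact (memLp_two_iff_integrable_sq_norm h1).2 h2
  have hmeas := (h.1.sub h'.1).1
  have h1 := ae_all_iff.2 fun n => h.2 (TopologicalSpace.denseSeq OneParticle n)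
  have h2 := ae_all_iff.2 fun n => h'.2 (TopologicalSpace.denseSeq OneParticle n)
  have hzero : ∀ᵐ p ∂spinMeasure, ∀ᵐ q ∂spinMeasure, K (p, q) - K' (p, q) = 0 := by
    filter_upwards [hslice h.1, hslice h'.1, h1, h2] with p hp hp' hp1 hp2
    refine ae_eq_zero_of_forall_integral_mul (hp.sub hp') fun n => ?_
    have e1 : Integrable (fun q => K (p, q) * TopologicalSpace.denseSeq OneParticle n q)
      spinMeasure := hp.integrable_mul (Lp.memLp _)
    have e2 : Integrable (fun q => K' (p, q) * TopologicalSpace.denseSeq OneParticle n q)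
      spinMeasure := hp'.integrable_mul (Lp.memLp _)
    simp only [sub_mul]
    rw [integral_sub e1 e2, ← hp1 n, ← hp2 n, sub_self]
  have h0 : ∫⁻ z, ‖(K - K') z‖ₑ ∂spinMeasure.prod spinMeasure = 0 := by
    rw [lintegral_prod _ hmeas.enorm]
    refine lintegral_eq_zero_of_ae_eq_zero ?_
    filter_upwards [hzero] with p hp
    refine lintegral_eq_zero_of_ae_eq_zero ?_
    filter_upwards [hp] with q hq
    simp [hq]
  rw [lintegral_eq_zero_iff' hmeas.enorm] at h0
  filter_upwards [h0] with z hz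
  simpa [sub_eq_zero] using hz

theorem isIntegralKernel_kernel {K : SpinSpace × SpinSpace → ℂ} (h : IsIntegralKernel γ K) :
    kernel γ =ᵐ[spinMeasure.prod spinMeasure] K := by
  have hex : ∃ K, IsIntegralKernel γ K := ⟨K, h⟩
  rw [kernel, dif_pos hex]
  exact hex.choose_spec.ae_eq h

theorem density_ae_eq (ht : IsTraceClass γ) (h0 : 0 ≤ γ) (o : NaturalOrbitals γ) :
    ∀ᵐ x : Space, density γ x = ∑ σ : Fin 2, o.spinDensity (x, σ) := by
  have hne : Nonempty (NaturalOrbitals γ) := ⟨o⟩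
  filter_upwards [ae_all_iff.2 (ae_spin_iff.1 (hne.some.spinDensity_ae_eq ht h0 o))] with x hx
  rw [density, dif_pos hne]
  exact Finset.sum_congr rfl fun σ _ => hx σ

end Orbitals

/-! ### Finiteness of the Coulomb integrals -/

section CoulombBounds

/-- The square of the Coulomb potential, cut off at distance `1`. -/
def nearSq (x : Space) : ℝ := (Metric.ball (0 : Space) 1).indicator (fun x => (1 / ‖x‖) ^ 2) x

/-- In polar coordinates the volume factor `r²` cancels `r⁻²`. -/
theorem integrable_nearSq : Integrable nearSq := by
  have h : IntegrableOn (fun x : Space => (1 / ‖x‖) ^ 2) (Metric.ball 0 1) := by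
    refine (integrableOn_fun_norm_addHaar (E := Space) volume (f := fun r => (1 / r) ^ 2)
      (r := 1)).2 ?_
    have hc : IntegrableOn (fun _ : ℝ => (1 : ℝ)) (Set.Ioo 0 1) := by simp
    refine hc.congr_fun (fun r hr => ?_) measurableSet_Ioo
    have : r ≠ 0 := hr.1.ne'
    simp only [finrank_euclideanSpace, Fintype.card_fin, smul_eq_mul]
    field_simp
  exact (integrable_indicator_iff measurableSet_ball).2 h

/-- The truncated Coulomb potential of a point `a`, cut off at distance `1` and height `M`. -/
def nearWeight (a : Space) (M : ℕ) (p : SpinSpace) : ℝ :=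
  (Metric.ball a 1).indicator (fun x => min (1 / ‖x - a‖) (M : ℝ)) p.1

theorem measurable_nearWeight (a : Space) (M : ℕ) : Measurable (nearWeight a M) := by
  have h : Measurable fun x : Space => min (1 / ‖x - a‖) (M : ℝ) := by fun_prop
  exact (h.indicator measurableSet_ball).comp measurable_fst

theorem nearWeight_nonneg (a : Space) (M : ℕ) (p : SpinSpace) : 0 ≤ nearWeight a M p :=
  Set.indicator_nonneg (fun _ _ => by positivity) _

theorem abs_nearWeight_le (a : Space) (M : ℕ) (p : SpinSpace) : |nearWeight a M p| ≤ M := by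
  rw [abs_of_nonneg (nearWeight_nonneg a M p)]
  exact Set.indicator_le' (fun _ _ => min_le_right _ _) (fun _ _ => by positivity) _

theorem nearWeight_sq_le (a : Space) (M : ℕ) (p : SpinSpace) :
    nearWeight a M p ^ 2 ≤ nearSq (p.1 - a) := by
  by_cases h : p.1 ∈ Metric.ball a 1
  · have h' : p.1 - a ∈ Metric.ball (0 : Space) 1 := by simpa [dist_eq_norm] using h
    rw [nearWeight, nearSq, Set.indicator_of_mem h, Set.indicator_of_mem h']
    exact pow_le_pow_left₀ (by positivity) (min_le_left _ _) 2
  · have h' : p.1 - a ∉ Metric.ball (0 : Space) 1 := by simpa [dist_eq_norm] using h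
    rw [nearWeight, nearSq, Set.indicator_of_notMem h, Set.indicator_of_notMem h']
    simp

theorem integrable_spin_nearSq (a : Space) :
    Integrable (fun p : SpinSpace => nearSq (p.1 - a)) spinMeasure :=
  integrable_spin_iff.2 fun _ => integrable_nearSq.comp_sub_right a

theorem integral_spin_nearSq (a : Space) :
    ∫ p : SpinSpace, nearSq (p.1 - a) ∂spinMeasure = 2 * ∫ x, nearSq x := by
  rw [integral_spin (integrable_spin_nearSq a), Fin.sum_univ_two]
  simp only [integral_sub_right_eq_self]
  ring

variable {γ S : OneParticle →L[ℂ] OneParticle}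

/-- `‖W γ f‖ ≤ C ‖(1 - Δ) γ f‖` for truncated Coulomb potentials `W`, uniformly in their position. -/
theorem exists_nearWeight_bound (hS : IsNegLaplacianMul γ S) :
    ∃ C : ℝ, 0 ≤ C ∧ ∀ (a : Space) (M : ℕ) (A : OneParticle →L[ℂ] OneParticle),
      (∀ f : OneParticle, ∀ᵐ p ∂spinMeasure, A f p = nearWeight a M p * f p) →
      ∀ f, ‖(A ∘L γ) f‖ ≤ C * ‖(S + γ) f‖ := by
  obtain ⟨C, hC, hb⟩ := exists_sup_bound
  -- Sup norm of `γ f` times the `L²` norm of the cut-off Coulomb potential on `Γ`; the factor `2`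
  -- counts the spins.
  refine ⟨√(2 * ∫ x, nearSq x) * C, by positivity, fun a M A hA f => ?_⟩
  have hI : 0 ≤ 2 * ∫ x, nearSq x := mul_nonneg zero_le_two
    (integral_nonneg fun x => Set.indicator_nonneg (fun _ _ => by positivity) _)
  refine le_of_sq_le_sq ?_ (by positivity)
  rw [← integral_norm_sq, mul_pow, mul_pow, Real.sq_sqrt hI, ← integral_spin_nearSq a, mul_assoc,
    ← mul_pow, ← integral_mul_const]
  refine integral_mono_of_nonneg (Filter.Eventually.of_forall fun _ => by positivity)
    ((integrable_spin_nearSq a).mul_const _) ?_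
  filter_upwards [hA (γ f), hb _ _ (hS f)] with p h1 h2
  rw [ContinuousLinearMap.comp_apply, h1, norm_mul, mul_pow, Complex.norm_real, Real.norm_eq_abs,
    sq_abs]
  exact mul_le_mul (nearWeight_sq_le a M p) (pow_le_pow_left₀ (norm_nonneg _) h2 2)
    (by positivity) ((sq_nonneg _).trans (nearWeight_sq_le a M p))

namespace NaturalOrbitals

variable (o : NaturalOrbitals γ)

/-- The integral is `tr(Wγ)`. Being dominated by `(1-Δ)γ`, the operator `Wγ` factors as `D(1-Δ)γ`
with `‖D‖ ≤ C`, so applying `D` to an expansion of `(1-Δ)γ` bounds its trace uniformly in position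
and height. The truncation is needed only to make `W` a bounded operator. -/
theorem exists_integral_nearWeight_le (ht : IsTraceClass γ) (h0 : 0 ≤ γ)
    (hS : IsNegLaplacianMul γ S) (hT : IsTraceClass (S + γ)) :
    ∃ C : ℝ, ∀ (a : Space) (M : ℕ),
      ∫ p, nearWeight a M p * o.spinDensity p ∂spinMeasure ≤ C := by
  obtain ⟨C, hC, hb⟩ := exists_nearWeight_bound hS
  obtain ⟨u, v, hs, h⟩ := hT
  refine ⟨∑' n, C * (‖u n‖ * ‖v n‖), fun a M => ?_⟩
  obtain ⟨A, hA⟩ := exists_mulOperator (measurable_nearWeight a M) (abs_nearWeight_le a M)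
  obtain ⟨D, hD, hD'⟩ := exists_factor_of_norm_le (T := S + γ) hC (hb a M A hA)
  have hle : ∀ n, ‖D (u n)‖ * ‖v n‖ ≤ C * (‖u n‖ * ‖v n‖) := fun n => by
    rw [← mul_assoc]
    gcongr
    exact hD' _
  have hsum : Summable fun n => ‖D (u n)‖ * ‖v n‖ :=
    Summable.of_nonneg_of_le (fun _ => by positivity) hle (hs.mul_left C)
  have hnorm := norm_trace_le (T := A ∘L γ) hsum fun f => by
    rw [← hD f]
    simpa using (h f).mapL D
  rw [← o.integral_mul_spinDensity ht h0 (measurable_nearWeight a M) (abs_nearWeight_le a M) hA,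
    Complex.norm_real] at hnorm
  exact (Real.le_norm_self _).trans (hnorm.trans (hsum.tsum_le_tsum hle (hs.mul_left C)))

/-- The Coulomb potential of the density is bounded. -/
theorem exists_lintegral_coulomb_le (ht : IsTraceClass γ) (h0 : 0 ≤ γ)
    (hS : IsNegLaplacianMul γ S) (hT : IsTraceClass (S + γ)) :
    ∃ C : ENNReal, C ≠ ⊤ ∧ ∀ a : Space,
      ∫⁻ p, ENNReal.ofReal (o.spinDensity p / ‖p.1 - a‖) ∂spinMeasure ≤ C := by
  obtain ⟨C, hC⟩ := o.exists_integral_nearWeight_le ht h0 hS hT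
  have hint := o.integrable_spinDensity ht h0
  have hpos := o.spinDensity_nonneg h0
  -- Near `a` the truncation is removed by monotone convergence; outside the unit ball `1/|x-a| ≤
  -- 1`, which costs at most the total mass.
  refine ⟨ENNReal.ofReal C + ∫⁻ p, ENNReal.ofReal (o.spinDensity p) ∂spinMeasure,
    ENNReal.add_ne_top.2 ⟨ENNReal.ofReal_ne_top, ?_⟩, fun a => ?_⟩
  · rw [← ofReal_integral_eq_lintegral_ofReal hint (Filter.Eventually.of_forall hpos)]
    exact ENNReal.ofReal_ne_top
  let near : SpinSpace → ℝ := fun p =>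
    (Metric.ball a 1).indicator (fun x => 1 / ‖x - a‖) p.1
  have hmeas : ∀ M : ℕ, Integrable (fun p => nearWeight a M p * o.spinDensity p) spinMeasure :=
    fun M => hint.bdd_mul (measurable_nearWeight a M).aestronglyMeasurable
      (Filter.Eventually.of_forall (abs_nearWeight_le a M))
  have hnear : ∫⁻ p, ENNReal.ofReal (near p * o.spinDensity p) ∂spinMeasure
      ≤ ENNReal.ofReal C := by
    refine le_of_tendsto' (lintegral_tendsto_of_tendsto_of_monotone
      (f := fun M p => ENNReal.ofReal (nearWeight a M p * o.spinDensity p))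
      (fun M => (hmeas M).1.aemeasurable.ennreal_ofReal)
      (Filter.Eventually.of_forall fun p M M' hM => ?_)
      (Filter.Eventually.of_forall fun p => ?_)) fun M => ?_
    · refine ENNReal.ofReal_le_ofReal (mul_le_mul_of_nonneg_right ?_ (hpos p))
      refine Set.indicator_le_indicator ?_
      exact min_le_min_left _ (by exact_mod_cast hM)
    -- At each point the truncation is eventually inactive, also at `p.1 = a`, where the quotient is
    -- `0` by convention.
    · refine tendsto_const_nhds.congr' ?_
      filter_upwards [Filter.eventually_ge_atTop ⌈1 / ‖p.1 - a‖⌉₊] with M hM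
      have : nearWeight a M p = near p := by
        by_cases h : p.1 ∈ Metric.ball a 1
        · simp only [nearWeight, near, Set.indicator_of_mem h, min_eq_left (Nat.ceil_le.1 hM)]
        · simp only [nearWeight, near, Set.indicator_of_notMem h]
      rw [this]
    · rw [← ofReal_integral_eq_lintegral_ofReal (hmeas M) (Filter.Eventually.of_forall
        fun p => mul_nonneg (nearWeight_nonneg a M p) (hpos p))]
      exact ENNReal.ofReal_le_ofReal (hC a M)
  refine le_trans ?_ (add_le_add_left hnear _)
  rw [← lintegral_add_right' _ hint.1.aemeasurable.ennreal_ofReal]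
  refine lintegral_mono fun p => ?_
  have hn : 0 ≤ near p := Set.indicator_nonneg (fun _ _ => by positivity) _
  rw [← ENNReal.ofReal_add (mul_nonneg hn (hpos p)) (hpos p)]
  refine ENNReal.ofReal_le_ofReal ?_
  have : 1 / ‖p.1 - a‖ ≤ near p + 1 := by
    by_cases h : p.1 ∈ Metric.ball a 1
    · simp [near, Set.indicator_of_mem h]
    · have h1 : 1 ≤ ‖p.1 - a‖ := by simpa [dist_eq_norm] using h
      have := div_le_one_of_le₀ h1 (norm_nonneg _)
      linarith
  calc o.spinDensity p / ‖p.1 - a‖ = 1 / ‖p.1 - a‖ * o.spinDensity p := by ring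
    _ ≤ (near p + 1) * o.spinDensity p := mul_le_mul_of_nonneg_right this (hpos p)
    _ = _ := by ring

theorem integrable_spinDensity_div_norm (ht : IsTraceClass γ) (h0 : 0 ≤ γ)
    (hS : IsNegLaplacianMul γ S) (hT : IsTraceClass (S + γ)) :
    Integrable (fun p => o.spinDensity p / ‖p.1‖) spinMeasure := by
  obtain ⟨C, hC, hb⟩ := o.exists_lintegral_coulomb_le ht h0 hS hT
  have hm : AEStronglyMeasurable (fun p => o.spinDensity p / ‖p.1‖) spinMeasure :=
    ((o.integrable_spinDensity ht h0).1.aemeasurable.div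
      (by fun_prop)).aestronglyMeasurable
  refine ⟨hm, ?_⟩
  rw [hasFiniteIntegral_iff_ofReal (Filter.Eventually.of_forall fun p =>
    div_nonneg (o.spinDensity_nonneg h0 p) (norm_nonneg _))]
  exact lt_of_le_of_lt (by simpa using hb 0) (lt_top_iff_ne_top.2 hC)

/-- By Tonelli: the inner integral is the bounded Coulomb potential, and the outer one is then at
most a multiple of the finite total mass. -/
theorem integrable_spinDensity_mul_div (ht : IsTraceClass γ) (h0 : 0 ≤ γ)
    (hS : IsNegLaplacianMul γ S) (hT : IsTraceClass (S + γ)) :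
    Integrable (fun z : SpinSpace × SpinSpace =>
      o.spinDensity z.1 * o.spinDensity z.2 / ‖z.1.1 - z.2.1‖)
      (spinMeasure.prod spinMeasure) := by
  obtain ⟨C, hC, hb⟩ := o.exists_lintegral_coulomb_le ht h0 hS hT
  have hint := o.integrable_spinDensity ht h0
  have hpos := o.spinDensity_nonneg h0
  have hm : AEMeasurable (fun z : SpinSpace × SpinSpace =>
      o.spinDensity z.1 * o.spinDensity z.2 / ‖z.1.1 - z.2.1‖)
      (spinMeasure.prod spinMeasure) :=
    (hint.mul_prod hint).1.aemeasurable.div (by fun_prop)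
  refine ⟨hm.aestronglyMeasurable, ?_⟩
  rw [hasFiniteIntegral_iff_ofReal (Filter.Eventually.of_forall fun z =>
    div_nonneg (mul_nonneg (hpos _) (hpos _)) (norm_nonneg _)),
    lintegral_prod_symm _ hm.ennreal_ofReal]
  calc _ ≤ ∫⁻ q, C * ENNReal.ofReal (o.spinDensity q) ∂spinMeasure := by
        refine lintegral_mono fun q => ?_
        have e : ∀ p : SpinSpace, ENNReal.ofReal (o.spinDensity p * o.spinDensity q / ‖p.1 - q.1‖)
            = ENNReal.ofReal (o.spinDensity p / ‖p.1 - q.1‖) * ENNReal.ofReal (o.spinDensity q) :=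
          fun p => by
            rw [← ENNReal.ofReal_mul (div_nonneg (hpos _) (norm_nonneg _))]
            ring_nf
        simp only [e]
        rw [lintegral_mul_const' _ _ ENNReal.ofReal_ne_top]
        exact mul_le_mul_left (hb q.1) _
    _ = C * ∫⁻ q, ENNReal.ofReal (o.spinDensity q) ∂spinMeasure :=
        lintegral_const_mul' _ _ hC
    _ < ⊤ := by
        rw [← ofReal_integral_eq_lintegral_ofReal hint (Filter.Eventually.of_forall hpos)]
        exact ENNReal.mul_lt_top (lt_top_iff_ne_top.2 hC) ENNReal.ofReal_lt_top

theorem ae_norm_kernelSum_sq_le (ht : IsTraceClass γ) (h0 : 0 ≤ γ) :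
    ∀ᵐ z ∂spinMeasure.prod spinMeasure,
      ‖o.kernelSum z‖ ^ 2 ≤ o.spinDensity z.1 * o.spinDensity z.2 := by
  filter_upwards [o.ae_prod_summable ht h0] with z hz
  exact (o.summable_kernelSum h0 hz.1 hz.2).2

theorem integrable_norm_kernelSum_sq_div (ht : IsTraceClass γ) (h0 : 0 ≤ γ)
    (hS : IsNegLaplacianMul γ S) (hT : IsTraceClass (S + γ)) :
    Integrable (fun z : SpinSpace × SpinSpace => ‖o.kernelSum z‖ ^ 2 / ‖z.1.1 - z.2.1‖)
      (spinMeasure.prod spinMeasure) := by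
  have hm : AEMeasurable (fun z : SpinSpace × SpinSpace =>
      ‖o.kernelSum z‖ ^ 2 / ‖z.1.1 - z.2.1‖) (spinMeasure.prod spinMeasure) :=
    ((o.aestronglyMeasurable_kernelSum ht h0).norm.pow 2).aemeasurable.div (by fun_prop)
  refine (o.integrable_spinDensity_mul_div ht h0 hS hT).mono' hm.aestronglyMeasurable ?_
  filter_upwards [o.ae_norm_kernelSum_sq_le ht h0] with z hz
  rw [Real.norm_of_nonneg (by positivity)]
  gcongr

end NaturalOrbitals

theorem integral_spin_prod {F : SpinSpace × SpinSpace → ℝ}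
    (hF : Integrable F (spinMeasure.prod spinMeasure)) :
    (∀ σ τ : Fin 2, Integrable fun z : Space × Space => F ((z.1, σ), (z.2, τ))) ∧
    ∫ z, F z ∂spinMeasure.prod spinMeasure
      = ∑ σ : Fin 2, ∑ τ : Fin 2, ∫ z : Space × Space, F ((z.1, σ), (z.2, τ)) := by
  have hemb : ∀ σ τ : Fin 2, MeasurableEmbedding
      (fun z : Space × Space => (((z.1, σ), (z.2, τ)) : SpinSpace × SpinSpace)) := fun σ τ =>
    (measurableEmbedding_spin σ).prodMap (measurableEmbedding_spin τ)
  have hμ : spinMeasure.prod spinMeasure = Measure.sum fun i : Fin 2 × Fin 2 =>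
      (volume : Measure (Space × Space)).map fun z => ((z.1, i.1), (z.2, i.2)) := by
    rw [spinMeasure_eq_sum, ← Measure.sum_fintype, Measure.prod_sum]
    congr 1
    ext1 i
    exact Measure.map_prod_map _ _ (measurableEmbedding_spin i.1).measurable
      (measurableEmbedding_spin i.2).measurable
  rw [hμ] at hF ⊢
  refine ⟨fun σ τ => ?_, ?_⟩
  · exact (hemb σ τ).integrable_map_iff.1 (hF.mono_measure (Measure.le_sum _ (σ, τ)))
  · rw [← (hasSum_integral_measure hF).tsum_eq, tsum_fintype, Fintype.sum_prod_type]
    simp only [(hemb _ _).integral_map]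

/-- The Hartree–Fock energy in terms of any natural orbitals. -/
theorem energy_eq (ht : IsTraceClass γ) (h0 : 0 ≤ γ) (hS : IsNegLaplacianMul γ S)
    (hT : IsTraceClass (S + γ)) (o : NaturalOrbitals γ) (Z : ℝ) :
    energy Z γ = kineticEnergy γ - Z * ∫ p, o.spinDensity p / ‖p.1‖ ∂spinMeasure
      + 1 / 2 * ∫ z, (o.spinDensity z.1 * o.spinDensity z.2 - ‖o.kernelSum z‖ ^ 2)
          / ‖z.1.1 - z.2.1‖ ∂spinMeasure.prod spinMeasure := by
  have hρ := density_ae_eq ht h0 o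
  have h1 : ∫ x : Space, Z * density γ x / ‖x‖
      = Z * ∫ p, o.spinDensity p / ‖p.1‖ ∂spinMeasure := by
    have hi := o.integrable_spinDensity_div_norm ht h0 hS hT
    rw [integral_spin hi, ← integral_finsetSum _ fun σ _ => integrable_spin_iff.1 hi σ,
      ← integral_const_mul]
    refine integral_congr_ae ?_
    filter_upwards [hρ] with x hx
    rw [hx, ← Finset.sum_div]
    ring
  have h2 : coulombEnergy (density γ) = 1 / 2 * ∫ z, o.spinDensity z.1 * o.spinDensity z.2
      / ‖z.1.1 - z.2.1‖ ∂spinMeasure.prod spinMeasure := by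
    have hi := o.integrable_spinDensity_mul_div ht h0 hS hT
    obtain ⟨hi1, hi2⟩ := integral_spin_prod hi
    rw [coulombEnergy, hi2]
    congr 1
    have e : ∀ σ, ∑ τ : Fin 2, ∫ z : Space × Space, o.spinDensity (z.1, σ) * o.spinDensity (z.2, τ)
        / ‖z.1 - z.2‖ = ∫ z : Space × Space, ∑ τ : Fin 2,
          o.spinDensity (z.1, σ) * o.spinDensity (z.2, τ) / ‖z.1 - z.2‖ := fun σ =>
      (integral_finsetSum _ fun τ _ => hi1 σ τ).symm
    simp only [e]
    rw [← integral_finsetSum _ fun σ _ => integrable_finsetSum _ fun τ _ => hi1 σ τ]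
    refine integral_congr_ae ?_
    filter_upwards [Measure.quasiMeasurePreserving_fst.ae hρ,
      Measure.quasiMeasurePreserving_snd.ae hρ] with z hz1 hz2
    rw [hz1, hz2]
    simp only [← Finset.sum_div, ← Finset.mul_sum, ← Finset.sum_mul]
  have h3 : exchangeEnergy γ = 1 / 2 * ∫ z, ‖o.kernelSum z‖ ^ 2
      / ‖z.1.1 - z.2.1‖ ∂spinMeasure.prod spinMeasure := by
    rw [exchangeEnergy]
    congr 1
    refine integral_congr_ae ?_
    filter_upwards [isIntegralKernel_kernel (o.isIntegralKernel_kernelSum ht h0)] with z hz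
    rw [hz]
  have h4 := integral_sub (o.integrable_spinDensity_mul_div ht h0 hS hT)
    (o.integrable_norm_kernelSum_sq_div ht h0 hS hT)
  simp only [← sub_div] at h4
  rw [energy, h1, h2, h3, h4]
  ring

end CoulombBounds

/-! ### Moving occupation between two fractional orbitals -/

section Perturbation

open InnerProductSpace

variable {γ S : OneParticle →L[ℂ] OneParticle}

namespace NaturalOrbitals

variable (o : NaturalOrbitals γ)

/-- An operator with nonnegative occupation numbers is nonnegative. -/
theorem nonneg_of_occupation_nonneg (h : ∀ n, 0 ≤ o.occupation n) : 0 ≤ γ := by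
  refine (ContinuousLinearMap.nonneg_iff_isPositive γ).2
    ((ContinuousLinearMap.isPositive_iff_complex γ).2 fun x => ?_)
  have h1 := (o.hasSum_apply x).mapL (innerSL ℂ x)
  have h2 : ∀ n, innerSL ℂ x (((o.occupation n : ℂ) * inner ℂ (o.orbital n) x) • o.orbital n)
      = ((o.occupation n * ‖inner ℂ (o.orbital n) x‖ ^ 2 : ℝ) : ℂ) := fun n => by
    rw [innerSL_apply_apply, inner_smul_right, mul_assoc, ← inner_conj_symm x, Complex.mul_conj']
    push_cast
    rfl
  simp only [h2] at h1
  have h3 := Complex.hasSum_iff _ _ |>.1 h1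
  simp only [Complex.ofReal_re, Complex.ofReal_im, innerSL_apply_apply] at h3
  have him : (inner ℂ x (γ x)).im = 0 := h3.2.unique hasSum_zero
  have hre : 0 ≤ (inner ℂ x (γ x)).re :=
    h3.1.nonneg fun n => mul_nonneg (h n) (by positivity)
  have e : inner ℂ (γ x) x = ((inner ℂ x (γ x)).re : ℂ) := by
    rw [← inner_conj_symm (γ x) x]
    apply Complex.ext
    · rw [Complex.conj_re, Complex.ofReal_re]
    · rw [Complex.conj_im, him, neg_zero, Complex.ofReal_im]
  rw [e]
  exact ⟨by simp, by simpa using hre⟩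

/-- The orbitals of `γ` are orbitals of `1 - γ`. -/
def oneSub : NaturalOrbitals (1 - γ) where
  index := o.index
  countable_index := o.countable_index
  orbital := o.orbital
  occupation n := 1 - o.occupation n
  eigen n := by
    rw [sub_apply, o.eigen]
    push_cast
    rw [sub_smul, one_smul]
    rfl

theorem le_one_of_occupation_le_one (h : ∀ n, o.occupation n ≤ 1) : γ ≤ 1 :=
  sub_nonneg.1 (o.oneSub.nonneg_of_occupation_nonneg fun n => sub_nonneg.2 (h n))

theorem eq_mul_self_of_occupation (h : ∀ n, o.occupation n = 0 ∨ o.occupation n = 1) :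
    γ = γ * γ := by
  ext1 f
  have h2 := (o.hasSum_apply f).mapL γ
  have e : ∀ n, γ (((o.occupation n : ℂ) * inner ℂ (o.orbital n) f) • o.orbital n)
      = ((o.occupation n : ℂ) * inner ℂ (o.orbital n) f) • o.orbital n := fun n => by
    rw [map_smul, o.eigen]
    rcases h n with h | h <;> simp [h]
  simp only [e] at h2
  exact (o.hasSum_apply f).unique h2

/-- If the trace is an integer and `γ` is not a projection, there are at least two fractional
occupation numbers. -/
theorem exists_two_fractional (ht : IsTraceClass γ) (h0 : 0 ≤ γ) (h1 : γ ≤ 1) {N : ℕ}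
    (hN : trace γ = N) (hne : γ ≠ γ * γ) :
    ∃ i j, i ≠ j ∧ (0 < o.occupation i ∧ o.occupation i < 1) ∧
      (0 < o.occupation j ∧ o.occupation j < 1) := by
  have hfrac : ∀ n, ¬ (o.occupation n = 0 ∨ o.occupation n = 1) →
      0 < o.occupation n ∧ o.occupation n < 1 := fun n hn => by
    rw [not_or] at hn
    exact ⟨lt_of_le_of_ne (o.occupation_nonneg h0 n) (Ne.symm hn.1),
      lt_of_le_of_ne (o.occupation_le_one h1 n) hn.2⟩
  obtain ⟨i, hi⟩ : ∃ i, ¬ (o.occupation i = 0 ∨ o.occupation i = 1) := by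
    by_contra! hcon
    exact hne (o.eq_mul_self_of_occupation hcon)
  by_contra! hcon
  have hint : ∀ n, n ≠ i → o.occupation n = 0 ∨ o.occupation n = 1 := fun n hn => by
    by_contra hn'
    exact absurd (hfrac n hn').2 (not_lt.2 (hcon i n (Ne.symm hn) (hfrac i hi) (hfrac n hn').1))
  -- With `i` as the only fractional index, the trace would be `λᵢ` plus the finite number of
  -- occupations equal to `1`, which lies strictly between consecutive integers.
  have hfin : {n | ¬ o.occupation n < 1}.Finite :=
    (o.summable_occupation ht).tendsto_cofinite_zero.eventually_lt_const zero_lt_one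
  classical
  have hi' : i ∉ hfin.toFinset := by simpa using (hfrac i hi).2
  have hsum : HasSum o.occupation (∑ n ∈ insert i hfin.toFinset, o.occupation n) := by
    refine hasSum_sum_of_ne_finset_zero fun n hn => ?_
    simp only [Finset.mem_insert, Set.Finite.mem_toFinset, Set.mem_ofPred_eq, not_or,
      not_not] at hn
    exact (hint n hn.1).resolve_right hn.2.ne
  have hone : ∀ n ∈ hfin.toFinset, o.occupation n = 1 := fun n hn => by
    have h2 : ¬ o.occupation n < 1 := by simpa using hn
    exact le_antisymm (o.occupation_le_one h1 n) (not_lt.1 h2)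
  rw [Finset.sum_insert hi', Finset.sum_congr rfl hone, Finset.sum_const, nsmul_eq_mul,
    mul_one] at hsum
  have hN' : HasSum o.occupation (N : ℝ) := by
    have := o.hasSum_occupation ht
    rw [hN] at this
    simpa using this.mapL Complex.reCLM
  have heq := hsum.unique hN'
  have h3 := hfrac i hi
  have h4 : hfin.toFinset.card < N := by
    have : (hfin.toFinset.card : ℝ) < N := by linarith
    exact_mod_cast this
  have h5 : N < hfin.toFinset.card + 1 := by
    have : (N : ℝ) < hfin.toFinset.card + 1 := by linarith
    exact_mod_cast this
  omega

/-- The operator `|ξᵢ⟩⟨ξᵢ| - |ξⱼ⟩⟨ξⱼ|`. -/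
def transfer (i j : o.index) : OneParticle →L[ℂ] OneParticle :=
  rankOne ℂ (o.orbital i) (o.orbital i) - rankOne ℂ (o.orbital j) (o.orbital j)

open Classical in
/-- The change of the occupation numbers caused by `transfer`. -/
def shift (i j n : o.index) : ℝ := (if n = i then 1 else 0) - if n = j then 1 else 0

theorem transfer_apply_orbital (i j n : o.index) :
    o.transfer i j (o.orbital n) = (o.shift i j n : ℂ) • o.orbital n := by
  classical
  have h : ∀ k, rankOne ℂ (o.orbital k) (o.orbital k) (o.orbital n)
      = (if n = k then (1 : ℂ) else 0) • o.orbital n := fun k => by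
    rw [rankOne_apply, orthonormal_iff_ite.1 o.orbital.orthonormal]
    by_cases hk : n = k
    · simp [hk]
    · simp [hk, Ne.symm hk]
  rw [transfer, sub_apply, h, h, ← sub_smul]
  congr 1
  unfold shift
  split_ifs <;> simp

/-- The orbitals of `γ` are orbitals of `γ + ε (|ξᵢ⟩⟨ξᵢ| - |ξⱼ⟩⟨ξⱼ|)`. -/
def perturb (i j : o.index) (ε : ℝ) : NaturalOrbitals (γ + (ε : ℂ) • o.transfer i j) where
  index := o.index
  countable_index := o.countable_index
  orbital := o.orbital
  occupation n := o.occupation n + ε * o.shift i j n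
  eigen n := by
    rw [add_apply, smul_apply, o.eigen, o.transfer_apply_orbital, smul_smul, ← add_smul]
    push_cast
    rfl

/-- The general algebra serves both the real density and the complex kernel. -/
theorem hasSum_shift {R : Type*} [NormedRing R] [NormedAlgebra ℝ R] (i j : o.index)
    (a : o.index → R) :
    HasSum (fun n => algebraMap ℝ R (o.shift i j n) * a n) (a i - a j) := by
  classical
  have h : ∀ k, HasSum (fun n => if n = k then a n else 0) (a k) := fun k => by
    convert hasSum_ite_eq k (a k) using 2 with n
    split_ifs with hn
    · rw [hn]
    · rfl
  have e : ∀ n, algebraMap ℝ R (o.shift i j n) * a n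
      = (if n = i then a n else 0) - if n = j then a n else 0 := fun n => by
    unfold shift
    split_ifs <;> simp
  simp only [e]
  exact (h i).sub (h j)

theorem spinDensity_perturb (i j : o.index) (ε : ℝ) {p : SpinSpace}
    (hp : Summable fun n => o.occupation n * ‖o.orbital n p‖ ^ 2) :
    (o.perturb i j ε).spinDensity p
      = o.spinDensity p + ε * (‖o.orbital i p‖ ^ 2 - ‖o.orbital j p‖ ^ 2) := by
  have h := hp.hasSum.add ((o.hasSum_shift i j fun n => ‖o.orbital n p‖ ^ 2).mul_left ε)
  rw [spinDensity, spinDensity, ← h.tsum_eq]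
  change ∑' n : o.index, (o.occupation n + ε * o.shift i j n) * ‖o.orbital n p‖ ^ 2 = _
  refine tsum_congr fun n => ?_
  simp only [Algebra.algebraMap_self, RingHom.id_apply]
  ring

theorem kernelSum_perturb (h0 : 0 ≤ γ) (i j : o.index) (ε : ℝ) {p q : SpinSpace}
    (hp : Summable fun n => o.occupation n * ‖o.orbital n p‖ ^ 2)
    (hq : Summable fun n => o.occupation n * ‖o.orbital n q‖ ^ 2) :
    (o.perturb i j ε).kernelSum (p, q) = o.kernelSum (p, q)
      + ε * (o.orbital i p * (starRingEnd ℂ) (o.orbital i q)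
        - o.orbital j p * (starRingEnd ℂ) (o.orbital j q)) := by
  have h := (o.summable_kernelSum h0 hp hq).1.hasSum.add
    ((o.hasSum_shift i j fun n => o.orbital n p * (starRingEnd ℂ) (o.orbital n q)).mul_left (ε : ℂ))
  rw [kernelSum, kernelSum, ← h.tsum_eq]
  change ∑' n : o.index, ((o.occupation n + ε * o.shift i j n : ℝ) : ℂ) *
    (o.orbital n p * (starRingEnd ℂ) (o.orbital n q)) = _
  refine tsum_congr fun n => ?_
  simp only [Complex.coe_algebraMap]
  push_cast
  ring

theorem isTraceClass_transfer (i j : o.index) : IsTraceClass (o.transfer i j) :=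
  (isTraceClass_rankOne _ _).sub (isTraceClass_rankOne _ _)

theorem trace_transfer (i j : o.index) : trace (o.transfer i j) = 0 := by
  rw [transfer, trace_sub (isTraceClass_rankOne _ _) (isTraceClass_rankOne _ _), trace_rankOne,
    trace_rankOne, inner_self_eq_norm_sq_to_K, inner_self_eq_norm_sq_to_K,
    o.orbital.orthonormal.1, o.orbital.orthonormal.1, sub_self]

/-- An eigenvector with nonzero eigenvalue is in the range of `γ`, hence in the domain of `-Δ`: `-Δ
ξᵢ = λᵢ⁻¹ S ξᵢ`. -/
theorem exists_isNegLaplacianMul_rankOne (hS : IsNegLaplacianMul γ S) {i : o.index}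
    (hi : 0 < o.occupation i) :
    ∃ s : OneParticle, IsNegLaplacianMul (rankOne ℂ (o.orbital i) (o.orbital i))
      (rankOne ℂ s (o.orbital i)) := by
  refine ⟨(o.occupation i : ℂ)⁻¹ • S (o.orbital i), fun f => ?_⟩
  have h := (hS (o.orbital i)).smul (o.occupation i : ℂ)⁻¹
  rw [o.eigen, smul_smul, inv_mul_cancel₀ (by exact_mod_cast hi.ne'), one_smul] at h
  exact h.smul _

theorem exists_isNegLaplacianMul_transfer (hS : IsNegLaplacianMul γ S) {i j : o.index}
    (hi : 0 < o.occupation i) (hj : 0 < o.occupation j) :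
    ∃ X, IsNegLaplacianMul (o.transfer i j) X ∧ IsTraceClass X := by
  obtain ⟨s, hs⟩ := o.exists_isNegLaplacianMul_rankOne hS hi
  obtain ⟨t, ht⟩ := o.exists_isNegLaplacianMul_rankOne hS hj
  refine ⟨_, ?_, (isTraceClass_rankOne s (o.orbital i)).sub (isTraceClass_rankOne t (o.orbital j))⟩
  rw [transfer, sub_eq_add_neg, sub_eq_add_neg, ← neg_one_smul ℂ, ← neg_one_smul ℂ (rankOne ℂ t _)]
  exact hs.add (ht.smul _)

theorem kineticEnergy_perturb (ht : IsTraceClass γ) (hS : IsNegLaplacianMul γ S)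
    (hT : IsTraceClass (S + γ)) {i j : o.index} {X : OneParticle →L[ℂ] OneParticle}
    (hX : IsNegLaplacianMul (o.transfer i j) X) (hX' : IsTraceClass X) (ε : ℝ) :
    kineticEnergy (γ + (ε : ℂ) • o.transfer i j)
      = kineticEnergy γ + ε * ((1 / 2 : ℂ) * trace X).re := by
  have hS' : IsTraceClass S := by simpa using hT.sub ht
  rw [kineticEnergy, kineticEnergy, (hS.add (hX.smul (ε : ℂ))).eq, hS.eq,
    trace_smul _ (hS'.add (hX'.smul _)), trace_smul _ hS', trace_add hS' (hX'.smul _),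
    trace_smul _ hX', mul_add, Complex.add_re, mul_left_comm, Complex.re_ofReal_mul]

theorem perturb_mem (ht : IsTraceClass γ) (h0 : 0 ≤ γ) (h1 : γ ≤ 1)
    {i j : o.index} (hij : i ≠ j) {ε : ℝ}
    (hi : |ε| ≤ o.occupation i) (hi' : |ε| ≤ 1 - o.occupation i)
    (hj : |ε| ≤ o.occupation j) (hj' : |ε| ≤ 1 - o.occupation j) :
    IsTraceClass (γ + (ε : ℂ) • o.transfer i j) ∧ 0 ≤ γ + (ε : ℂ) • o.transfer i j ∧
      γ + (ε : ℂ) • o.transfer i j ≤ 1 := by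
  have hocc : ∀ n : o.index,
      0 ≤ o.occupation n + ε * o.shift i j n ∧ o.occupation n + ε * o.shift i j n ≤ 1 := by
    intro n
    have hn0 := o.occupation_nonneg h0 n
    have hn1 := o.occupation_le_one h1 n
    unfold shift
    rw [abs_le] at hi hi' hj hj'
    by_cases h : n = i
    · subst h
      rw [if_pos rfl, if_neg hij]
      constructor <;> linarith
    · by_cases h' : n = j
      · subst h'
        rw [if_pos rfl, if_neg h]
        constructor <;> linarith
      · rw [if_neg h, if_neg h']
        constructor <;> linarith
  exact ⟨ht.add ((o.isTraceClass_transfer i j).smul _),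
    (o.perturb i j ε).nonneg_of_occupation_nonneg fun n => (hocc n).1,
    (o.perturb i j ε).le_one_of_occupation_le_one fun n => (hocc n).2⟩

/-- Two orthonormal orbitals have a nonvanishing Slater determinant. -/
theorem integral_slater_pos {i j : o.index} (hij : i ≠ j)
    (hint : Integrable (fun z : SpinSpace × SpinSpace =>
      ‖o.orbital i z.1 * o.orbital j z.2 - o.orbital j z.1 * o.orbital i z.2‖ ^ 2
        / ‖z.1.1 - z.2.1‖) (spinMeasure.prod spinMeasure)) :
    0 < ∫ z, ‖o.orbital i z.1 * o.orbital j z.2 - o.orbital j z.1 * o.orbital i z.2‖ ^ 2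
      / ‖z.1.1 - z.2.1‖ ∂spinMeasure.prod spinMeasure := by
  have hnn : ∀ z : SpinSpace × SpinSpace,
      0 ≤ ‖o.orbital i z.1 * o.orbital j z.2 - o.orbital j z.1 * o.orbital i z.2‖ ^ 2
        / ‖z.1.1 - z.2.1‖ := fun z => by positivity
  refine lt_of_le_of_ne (integral_nonneg hnn) fun h0 => ?_
  -- The Coulomb weight is positive off the null diagonal, so the determinant would vanish almost
  -- everywhere. Integrating it against the conjugate of `ξⱼ(q)` gives `ξᵢ(p) = 0` by
  -- orthonormality.
  have hz := Measure.ae_ae_of_ae_prod ((integral_eq_zero_iff_of_nonneg hnn hint).1 h0.symm)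
  have hi0 : o.orbital i = 0 := by
    refine (Lp.eq_zero_iff_ae_eq_zero).2 ?_
    filter_upwards [hz] with p hp
    have hne : ∀ᵐ q ∂spinMeasure, q.1 ≠ p.1 := ae_spin_iff.2 fun σ => by
      simp only
      exact Measure.ae_ne volume p.1
    have heq : ∀ᵐ q ∂spinMeasure, o.orbital i p * o.orbital j q = o.orbital j p * o.orbital i q := by
      filter_upwards [hp, hne] with q hq hqne
      have hd : ‖p.1 - q.1‖ ≠ 0 := norm_ne_zero_iff.2 (sub_ne_zero.2 (Ne.symm hqne))
      have := (div_eq_zero_iff.1 hq).resolve_right hd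
      exact sub_eq_zero.1 (norm_eq_zero.1 (pow_eq_zero_iff two_ne_zero |>.1 this))
    have e : o.orbital i p * inner ℂ (o.orbital j) (o.orbital j)
        = o.orbital j p * inner ℂ (o.orbital j) (o.orbital i) := by
      rw [inner_eq_integral, inner_eq_integral, ← integral_const_mul, ← integral_const_mul]
      refine integral_congr_ae ?_
      filter_upwards [heq] with q hq
      linear_combination (starRingEnd ℂ) (o.orbital j q) * hq
    rw [o.orbital.orthonormal.2 (Ne.symm hij), inner_self_eq_norm_sq_to_K,
      o.orbital.orthonormal.1] at e
    simpa using e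
  exact o.orbital.orthonormal.ne_zero i hi0

/-- Adding the values at `±ε` cancels the linear terms. The quadratic coefficient is
`(|a|²-|b|²)(|c|²-|d|²) - |a c̄ - b d̄|²`, where `|ac|²` and `|bd|²` drop out and the rest is `-|ad
- bc|²`. -/
theorem norm_sq_slater_identity (n m : ℝ) (K a b c d : ℂ) (ε : ℝ) :
    ((n + ε * (‖a‖ ^ 2 - ‖b‖ ^ 2)) * (m + ε * (‖c‖ ^ 2 - ‖d‖ ^ 2))
        - ‖K + ε * (a * (starRingEnd ℂ) c - b * (starRingEnd ℂ) d)‖ ^ 2)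
      + ((n + -ε * (‖a‖ ^ 2 - ‖b‖ ^ 2)) * (m + -ε * (‖c‖ ^ 2 - ‖d‖ ^ 2))
        - ‖K + (-ε : ℝ) * (a * (starRingEnd ℂ) c - b * (starRingEnd ℂ) d)‖ ^ 2)
      - 2 * (n * m - ‖K‖ ^ 2) = -(2 * ε ^ 2) * ‖a * d - b * c‖ ^ 2 := by
  simp only [← Complex.normSq_eq_norm_sq, Complex.normSq_apply, Complex.add_re, Complex.add_im,
    Complex.sub_re, Complex.sub_im, Complex.mul_re, Complex.mul_im, Complex.conj_re,
    Complex.conj_im, Complex.ofReal_re, Complex.ofReal_im]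
  ring

/-- Strict midpoint concavity of the energy in the direction `|ξᵢ⟩⟨ξᵢ| - |ξⱼ⟩⟨ξⱼ|`. -/
theorem energy_perturb_add_lt (ht : IsTraceClass γ) (h0 : 0 ≤ γ) (hS : IsNegLaplacianMul γ S)
    (hT : IsTraceClass (S + γ)) {i j : o.index} (hij : i ≠ j)
    {X : OneParticle →L[ℂ] OneParticle} (hX : IsNegLaplacianMul (o.transfer i j) X)
    (hX' : IsTraceClass X) {ε : ℝ} (hε : ε ≠ 0)
    (hpos : 0 ≤ γ + (ε : ℂ) • o.transfer i j)
    (hneg : 0 ≤ γ + ((-ε : ℝ) : ℂ) • o.transfer i j) (Z : ℝ) :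
    energy Z (γ + (ε : ℂ) • o.transfer i j) + energy Z (γ + ((-ε : ℝ) : ℂ) • o.transfer i j)
      < 2 * energy Z γ := by
  have hγt : ∀ δ : ℝ, IsTraceClass (γ + (δ : ℂ) • o.transfer i j) := fun δ =>
    ht.add ((o.isTraceClass_transfer i j).smul _)
  have hγS : ∀ δ : ℝ, IsNegLaplacianMul (γ + (δ : ℂ) • o.transfer i j) (S + (δ : ℂ) • X) :=
    fun δ => hS.add (hX.smul _)
  have hγT : ∀ δ : ℝ, IsTraceClass (S + (δ : ℂ) • X + (γ + (δ : ℂ) • o.transfer i j)) := fun δ => by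
    rw [add_add_add_comm]
    exact hT.add ((hX'.smul _).add ((o.isTraceClass_transfer i j).smul _))
  have hint : ∀ {γ S : OneParticle →L[ℂ] OneParticle} (o : NaturalOrbitals γ), IsTraceClass γ →
      0 ≤ γ → IsNegLaplacianMul γ S → IsTraceClass (S + γ) →
      Integrable (fun z : SpinSpace × SpinSpace => (o.spinDensity z.1 * o.spinDensity z.2
        - ‖o.kernelSum z‖ ^ 2) / ‖z.1.1 - z.2.1‖) (spinMeasure.prod spinMeasure) :=
    fun o ht h0 hS hT => by
      simp only [sub_div]
      exact (o.integrable_spinDensity_mul_div ht h0 hS hT).sub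
        (o.integrable_norm_kernelSum_sq_div ht h0 hS hT)
  have hnuc : (∫ p, (o.perturb i j ε).spinDensity p / ‖p.1‖ ∂spinMeasure)
      + (∫ p, (o.perturb i j (-ε)).spinDensity p / ‖p.1‖ ∂spinMeasure)
      = 2 * ∫ p, o.spinDensity p / ‖p.1‖ ∂spinMeasure := by
    rw [← integral_add
      ((o.perturb i j ε).integrable_spinDensity_div_norm (hγt _) hpos (hγS _) (hγT _))
      ((o.perturb i j (-ε)).integrable_spinDensity_div_norm (hγt _) hneg (hγS _) (hγT _)),
      ← integral_const_mul]
    refine integral_congr_ae ?_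
    filter_upwards [o.ae_summable ht h0] with p hp
    rw [o.spinDensity_perturb i j ε hp, o.spinDensity_perturb i j (-ε) hp]
    ring
  let D : SpinSpace × SpinSpace → ℝ := fun z =>
    ‖o.orbital i z.1 * o.orbital j z.2 - o.orbital j z.1 * o.orbital i z.2‖ ^ 2
      / ‖z.1.1 - z.2.1‖
  have hp := hint (o.perturb i j ε) (hγt _) hpos (hγS _) (hγT _)
  have hn := hint (o.perturb i j (-ε)) (hγt _) hneg (hγS _) (hγT _)
  have hz := hint o ht h0 hS hT
  have hae : ∀ᵐ z ∂spinMeasure.prod spinMeasure,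
      ((o.perturb i j ε).spinDensity z.1 * (o.perturb i j ε).spinDensity z.2
        - ‖(o.perturb i j ε).kernelSum z‖ ^ 2) / ‖z.1.1 - z.2.1‖
      + ((o.perturb i j (-ε)).spinDensity z.1 * (o.perturb i j (-ε)).spinDensity z.2
        - ‖(o.perturb i j (-ε)).kernelSum z‖ ^ 2) / ‖z.1.1 - z.2.1‖
      - 2 * ((o.spinDensity z.1 * o.spinDensity z.2 - ‖o.kernelSum z‖ ^ 2) / ‖z.1.1 - z.2.1‖)
      = -(2 * ε ^ 2) * D z := by
    filter_upwards [o.ae_prod_summable ht h0] with z hz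
    rw [o.spinDensity_perturb i j ε hz.1, o.spinDensity_perturb i j ε hz.2,
      o.spinDensity_perturb i j (-ε) hz.1, o.spinDensity_perturb i j (-ε) hz.2,
      o.kernelSum_perturb h0 i j ε hz.1 hz.2, o.kernelSum_perturb h0 i j (-ε) hz.1 hz.2]
    have key := norm_sq_slater_identity (o.spinDensity z.1) (o.spinDensity z.2) (o.kernelSum z)
      (o.orbital i z.1) (o.orbital j z.1) (o.orbital i z.2) (o.orbital j z.2) ε
    simp only [D]
    rw [← mul_div_assoc, ← mul_div_assoc, ← add_div, ← sub_div, key]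
  have hc : -(2 * ε ^ 2) ≠ 0 := by
    have : 0 < ε ^ 2 := by positivity
    linarith
  -- The Slater integrand is a nonzero multiple of a second difference of integrable functions, so
  -- its integrability needs no separate estimate.
  have hD : Integrable D (spinMeasure.prod spinMeasure) := by
    have h := (((hp.add hn).sub (hz.const_mul 2)).congr hae).const_mul (-(2 * ε ^ 2))⁻¹
    refine h.congr (Filter.Eventually.of_forall fun z => ?_)
    exact inv_mul_cancel_left₀ hc (D z)
  have hDpos : 0 < ∫ z, D z ∂spinMeasure.prod spinMeasure := o.integral_slater_pos hij hD
  have hcou := integral_congr_ae hae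
  have hsub := integral_sub (hp.add hn) (hz.const_mul 2)
  have hadd := integral_add hp hn
  simp only [Pi.add_apply] at hsub
  rw [hsub, hadd, integral_const_mul, integral_const_mul] at hcou
  rw [energy_eq (hγt _) hpos (hγS _) (hγT _) (o.perturb i j ε),
    energy_eq (hγt _) hneg (hγS _) (hγT _) (o.perturb i j (-ε)), energy_eq ht h0 hS hT o,
    o.kineticEnergy_perturb ht hS hT hX hX', o.kineticEnergy_perturb ht hS hT hX hX']
  have hε2 : 0 < ε ^ 2 := by positivity
  nlinarith [mul_pos hε2 hDpos, congrArg (fun t => Z * t) hnuc]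

end NaturalOrbitals

/-- A density matrix of integer trace that is not a projection does not minimize the energy. -/
theorem exists_energy_lt (Z : ℝ) {N : ℕ} (hγ : γ ∈ densityMatricesOfTrace N)
    (hne : γ ≠ γ * γ) :
    ∃ γ' ∈ densityMatricesOfTrace N, energy Z γ' < energy Z γ := by
  obtain ⟨⟨ht, h0, h1, S, hS, hT⟩, hN⟩ := hγ
  obtain ⟨o⟩ := exists_naturalOrbitals ht h0
  obtain ⟨i, j, hij, hi, hj⟩ := o.exists_two_fractional ht h0 h1 hN hne
  obtain ⟨X, hX, hX'⟩ := o.exists_isNegLaplacianMul_transfer hS hi.1 hj.1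
  -- The distance of the two occupation numbers from `{0, 1}` is a step that is admissible in both
  -- directions.
  obtain ⟨ε, hε, hεm⟩ : ∃ ε : ℝ, 0 < ε ∧ ε ≤ min (min (o.occupation i) (1 - o.occupation i))
      (min (o.occupation j) (1 - o.occupation j)) :=
    ⟨_, lt_min (lt_min hi.1 (sub_pos.2 hi.2)) (lt_min hj.1 (sub_pos.2 hj.2)), le_rfl⟩
  simp only [le_min_iff] at hεm
  have hmem : ∀ δ : ℝ, |δ| = ε →
      γ + (δ : ℂ) • o.transfer i j ∈ densityMatricesOfTrace N := fun δ hδ => by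
    obtain ⟨ht', h0', h1'⟩ := o.perturb_mem ht h0 h1 hij (hδ.trans_le hεm.1.1)
      (hδ.trans_le hεm.1.2) (hδ.trans_le hεm.2.1) (hδ.trans_le hεm.2.2)
    refine ⟨⟨ht', h0', h1', _, hS.add (hX.smul (δ : ℂ)), ?_⟩, ?_⟩
    · rw [add_add_add_comm]
      exact hT.add ((hX'.smul _).add ((o.isTraceClass_transfer i j).smul _))
    · rw [trace_add ht ((o.isTraceClass_transfer i j).smul _),
        trace_smul _ (o.isTraceClass_transfer i j), o.trace_transfer, mul_zero, add_zero, hN]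
  have hp := hmem ε (abs_of_pos hε)
  have hn := hmem (-ε) (by rw [abs_neg, abs_of_pos hε])
  have key := o.energy_perturb_add_lt ht h0 hS hT hij hX hX' hε.ne' hp.1.2.1 hn.1.2.1 Z
  by_cases h : energy Z (γ + (ε : ℂ) • o.transfer i j) < energy Z γ
  · exact ⟨_, hp, h⟩
  · exact ⟨_, hn, by linarith⟩

end Perturbation

end HartreeFock

end

/-! ### The theorem and its consequence for minimizers -/

theorem mainTheorem6 (Z : ℝ) (N : ℕ) :
    (∀ γ ∈ HartreeFock.densityMatricesOfTrace N, γ ≠ γ * γ →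
      ∃ γ' ∈ HartreeFock.densityMatricesOfTrace N,
        HartreeFock.energy Z γ' < HartreeFock.energy Z γ) ∧
    (∀ γ ∈ HartreeFock.densityMatricesOfTrace N,
      IsMinOn (HartreeFock.energy Z) (HartreeFock.densityMatricesOfTrace N) γ →
        IsStarProjection γ) := by
  refine ⟨fun γ hγ hne => HartreeFock.exists_energy_lt Z hγ hne, fun γ hγ hmin => ?_⟩
  have hidem : γ = γ * γ := by
    by_contra hne
    obtain ⟨γ', hγ', hlt⟩ := HartreeFock.exists_energy_lt Z hγ hne
    exact (not_lt.2 (isMinOn_iff.1 hmin γ' hγ')) hlt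
  exact ⟨hidem.symm,
    ((ContinuousLinearMap.nonneg_iff_isPositive γ).1 hγ.1.2.1).isSelfAdjoint⟩
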